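/- Let $(X,\mathcal A,\mu)$ be a probability space (for example a Lebesgue space) and let $\{T^z\}_{z\in\mathbb Z^2}$ be a $\mathbb Z^2$-action on it by invertible (mod $0$) measure preserving maps, with $T^{z}\circ T^{w}=T^{z+w}$ $\mu$-almost everywhere. Put $\hat T^z f=f\circ T^z$ on the complex space $L_2(X,\mu)$; let $I$ be the identity operator, $\Theta$ the orthogonal projection of $L_2(X,\mu)$ onto the constants, and, for any probability space $(Y,\nu)$, let $L_2^0(Y,\nu)$ be the orthogonal complement of the constants in $L_2(Y,\nu)$. For a $\mathbb Z^2$-action $\{S^z\}$ on $(Y,\nu)$ a cyclic subspace is the closed linear span of $\{\hat S^z h : z\in\mathbb Z^2\}$ for some $h\in L_2(Y,\nu)$. The action has simple spectrum if $L_2^0(Y,\nu)$ is a cyclic subspace; it has homogeneous spectrum of multiplicity $n$ if $L_2^0(Y,\nu)$ is an orthogonal sum $\bigoplus_{i=1}^n C_i$ of cyclic subspaces $C_i$ such that the restrictions of $\{\hat S^z\}$ to the $C_i$ are pairwise unitarily isomorphic. Suppose that $\{T^z\}$ is totally ergodic, i.e. $T^z$ is ergodic for every $z\neq 0$, that 1.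 $\{T^z\}$ has simple spectrum, and 2. for $m_1=(1,0)$, $m_2=(0,1)$, $m_3=(1,1)$ and each $j\in\{1,2,3\}$ there are positive numbers $a_j,b_j,c_j$ with $a_j+b_j+c_j=1$ and a sequence $(p_i)$ in $\mathbb Z^2$ such that $\hat T^{p_i}\to a_jI+b_j\hat T^{m_j}+c_j\Theta$ in the weak operator topology as $i\to\infty$. Then the diagonal action $\{T^z\times T^z\}_{z\in\mathbb Z^2}$ on $(X\times X,\mu\times\mu)$ has homogeneous spectrum of multiplicity two. -/

import Mathlib

open MeasureTheory Filter Topology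

noncomputable section

namespace Z2Spectrum

/-- A measure preserving `ℤ²`-action on `(X, μ)` by automorphisms. As usual in the theory of
Lebesgue spaces, maps are considered up to null sets, so the group law is required almost
everywhere; `map_zero` and `map_add` make every `T^z` invertible mod 0 with inverse `T^{-z}`. -/
structure Action {X : Type*} [MeasurableSpace X] (μ : Measure X) where
  toFun : ℤ × ℤ → X → X
  measurePreserving : ∀ z, MeasurePreserving (toFun z) μ μ
  map_zero : toFun 0 =ᵐ[μ] id
  map_add : ∀ z w, toFun (z + w) =ᵐ[μ] toFun z ∘ toFun w

section Operators

variable {H : Type*} [NormedAddCommGroup H] [InnerProductSpace ℂ H]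

/-- `C` is the closed linear span of the orbit `{U^z h}` of some vector `h`. -/
def IsCyclicSubspace (U : ℤ × ℤ → H →ₗᵢ[ℂ] H) (C : Submodule ℂ H) : Prop :=
  ∃ h : H, (Submodule.span ℂ (Set.range fun z => U z h)).topologicalClosure = C

/-- `C` is invariant, and some unitary isomorphism of `C` onto `D` intertwines the restrictions of
`{U^z}` to `C` and to `D` (so that `D` is invariant as well). -/
def RestrictionsIsomorphic (U : ℤ × ℤ → H →ₗᵢ[ℂ] H) (C D : Submodule ℂ H) : Prop :=
  ∃ (hC : ∀ z, ∀ x ∈ C, U z x ∈ C) (V : C ≃ₗᵢ[ℂ] D),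
    ∀ (z : ℤ × ℤ) (x : C), (V ⟨U z x, hC z x x.2⟩ : H) = U z (V x : H)

/-- The operator `A` is the limit of some sequence `U^{p_i}` in the weak operator topology. -/
def HasWeakLimit (U : ℤ × ℤ → H →ₗᵢ[ℂ] H) (A : H →L[ℂ] H) : Prop :=
  ∃ p : ℕ → ℤ × ℤ, ∀ f g : H,
    Tendsto (fun i => inner ℂ g (U (p i) f)) atTop (𝓝 (inner ℂ g (A f)))

end Operators

section Measure

variable {X : Type*} [MeasurableSpace X]

/-- The constant functions in `L²(X, μ)`. -/
def constants (μ : Measure X) [IsFiniteMeasure μ] : Submodule ℂ (Lp ℂ 2 μ) :=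
  Submodule.span ℂ {Lp.const 2 μ (1 : ℂ)}

instance (μ : Measure X) [IsFiniteMeasure μ] : (constants μ).HasOrthogonalProjection := by
  unfold constants
  infer_instance

/-- The space `L²₀(X, μ)`, the orthogonal complement of the constants. -/
def L20 (μ : Measure X) [IsFiniteMeasure μ] : Submodule ℂ (Lp ℂ 2 μ) :=
  (constants μ)ᗮ

/-- The orthogonal projection `Θ` of `L²(X, μ)` onto the constants. -/
def Theta (μ : Measure X) [IsFiniteMeasure μ] : Lp ℂ 2 μ →L[ℂ] Lp ℂ 2 μ :=
  (constants μ).starProjection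

namespace Action

variable {μ : Measure X}

/-- The operator `f ↦ f ∘ T^z` on `L²(X, μ)`. -/
def koopman (T : Action μ) (z : ℤ × ℤ) : Lp ℂ 2 μ →ₗᵢ[ℂ] Lp ℂ 2 μ :=
  Lp.compMeasurePreservingₗᵢ ℂ (T.toFun z) (T.measurePreserving z)

/-- Every element of the action other than the identity element is ergodic. -/
def IsTotallyErgodic (T : Action μ) : Prop :=
  ∀ z, z ≠ 0 → Ergodic (T.toFun z) μ

def HasSimpleSpectrum [IsFiniteMeasure μ] (T : Action μ) : Prop :=
  IsCyclicSubspace T.koopman (L20 μ)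

/-- Homogeneous spectrum of multiplicity `n`: `L²₀` is the orthogonal sum of `n` cyclic
subspaces on which the action restricts to pairwise isomorphic actions. -/
def HasHomogeneousSpectrum [IsFiniteMeasure μ] (T : Action μ) (n : ℕ) : Prop :=
  ∃ C : Fin n → Submodule ℂ (Lp ℂ 2 μ),
    (∀ i, IsCyclicSubspace T.koopman (C i)) ∧
    (Pairwise fun i j => C i ⟂ C j) ∧
    (⨆ i, C i) = L20 μ ∧
    ∀ i j, RestrictionsIsomorphic T.koopman (C i) (C j)

/-- The diagonal action `{T^z × T^z}` on `(X × X, μ × μ)`. -/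
def diag [SFinite μ] (T : Action μ) : Action (μ.prod μ) where
  toFun z := Prod.map (T.toFun z) (T.toFun z)
  measurePreserving z := (T.measurePreserving z).prod (T.measurePreserving z)
  map_zero := by
    filter_upwards [Measure.quasiMeasurePreserving_fst.ae T.map_zero,
      Measure.quasiMeasurePreserving_snd.ae T.map_zero] with x h1 h2
    exact Prod.ext h1 h2
  map_add z w := by
    filter_upwards [Measure.quasiMeasurePreserving_fst.ae (T.map_add z w),
      Measure.quasiMeasurePreserving_snd.ae (T.map_add z w)] with x h1 h2
    exact Prod.ext h1 h2

end Action

end Measure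

end Z2Spectrum

end

/-! Let `E` be the constants in L²(X), `H` their orthogonal complement, `h` a cyclic vector of `H`,
and `e` the constant function 1. L²(X × X) is the Hilbert tensor square of L²(X), so the complement
of its constants is (H ⊗ E) ⊕ (E ⊗ H) ⊕ (H ⊗ H), and the flip splits H ⊗ H into symmetric tensors S
and antisymmetric tensors Q. The two required subspaces are C = (H ⊗ E) ⊕ S and D = (E ⊗ H) ⊕ Q.

S is generated by h ⊗ h. On H ⊗ H the operators U^p ⊗ U^p converge weakly to (a + bU^m) ⊗ (a +
bU^m), so every closed invariant subspace of H ⊗ H is preserved by U^m ⊗ 1 + 1 ⊗ U^m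
(`symSum_mem_of_hasLimitOn`). The three given values of m generate all such sums by a Chebyshev-type
recursion (`symSum_mem`), and these produce the symmetrization of every U^α h ⊗ U^β h
(`add_swap_mem`).

C is generated by h ⊗ e + h ⊗ h, because no nonzero operator coming from the construction
intertwines H ⊗ E with H ⊗ H (`tens_mem_cyclic_add`). On H ⊗ E the weak limit is a + b(U^m ⊗ U^m),
so an image F in H ⊗ H satisfies (a + b(U^m ⊗ U^m))F = ((a + bU^m) ⊗ (a + bU^m))F. This relation
says that 1 ⊗ U^m acts, on a vector derived from F, as v ⊗ 1 with v a Möbius transform of U^m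
(`exists_moebius`). Doing so for both generators gives a vector fixed by a whole family v_q ⊗ U^q.
Along the sequence p the second factor behaves like a + bU^m, of norm at most a + b < 1, so the
vector is zero (`eq_zero_of_map_eq_self`, `eq_zero_of_relations`).

C and D are isomorphic. The flip maps H ⊗ E onto E ⊗ H, and an operator built from U^m ⊗ 1 - 1 ⊗ U^m
maps S injectively and densely into Q (`exists_antisymmetric_intertwiner`). Polar decomposition
makes the combined operator unitary, and the cyclicity of C passes to D. -/

noncomputable section

namespace Z2Spectrum

open scoped TensorProduct

/-! ### Closed spans and weak limits in Hilbert space. -/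

section HilbertSpace

variable {K : Type*} [NormedAddCommGroup K] [InnerProductSpace ℂ K]

/-- A uniformly bounded family of functionals tending to zero pointwise on a set tends to zero
pointwise on the closed span of this set. -/
theorem tendsto_zero_of_mem_closure_span (φ : ℕ → K →L[ℂ] ℂ) (M : ℝ) (hM : ∀ i, ‖φ i‖ ≤ M)
    (s : Set K) (hs : ∀ x ∈ s, Tendsto (fun i => φ i x) atTop (𝓝 0)) {x : K}
    (hx : x ∈ (Submodule.span ℂ s).topologicalClosure) :
    Tendsto (fun i => φ i x) atTop (𝓝 0) := by
  have hspan : ∀ x ∈ Submodule.span ℂ s, Tendsto (fun i => φ i x) atTop (𝓝 0) := by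
    intro x hx
    induction hx using Submodule.span_induction with
    | mem x h => exact hs x h
    | zero => simp
    | add x y _ _ h1 h2 => simpa using h1.add h2
    | smul c x _ h => simpa using h.const_mul c
  have hM0 : 0 ≤ M := (norm_nonneg _).trans (hM 0)
  rw [Metric.tendsto_atTop]
  intro ε hε
  have hx' : x ∈ closure (Submodule.span ℂ s : Set K) := hx
  -- With this radius the error `M * ‖x - y‖` is below ε/2; the `+ 1` covers `M = 0`.
  obtain ⟨y, hy, hxy⟩ := Metric.mem_closure_iff.1 hx' (ε / (2 * (M + 1))) (by positivity)
  obtain ⟨N, hN⟩ := Metric.tendsto_atTop.1 (hspan y hy) (ε / 2) (by positivity)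
  refine ⟨N, fun n hn => ?_⟩
  have h1 := hN n hn
  rw [dist_zero_right] at h1 ⊢
  have h2 : ‖φ n (x - y)‖ ≤ M * ‖x - y‖ :=
    ((φ n).le_opNorm _).trans (mul_le_mul_of_nonneg_right (hM n) (norm_nonneg _))
  rw [dist_eq_norm, lt_div_iff₀ (by positivity)] at hxy
  have h3 : φ n x = φ n (x - y) + φ n y := by simp
  rw [h3]
  refine (norm_add_le _ _).trans_lt ?_
  nlinarith [norm_nonneg (x - y)]

theorem tendsto_inner_zero_of_mem_closure_span (O : ℕ → K →L[ℂ] K) (M : ℝ)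
    (hM : ∀ i, ‖O i‖ ≤ M) (s t : Set K)
    (hst : ∀ x ∈ s, ∀ y ∈ t, Tendsto (fun i => inner ℂ y (O i x)) atTop (𝓝 0)) {x y : K}
    (hx : x ∈ (Submodule.span ℂ s).topologicalClosure)
    (hy : y ∈ (Submodule.span ℂ t).topologicalClosure) :
    Tendsto (fun i => inner ℂ y (O i x)) atTop (𝓝 0) := by
  have h1 : ∀ y ∈ t, Tendsto (fun i => inner ℂ y (O i x)) atTop (𝓝 0) := by
    intro y hy
    refine tendsto_zero_of_mem_closure_span (fun i => (innerSL ℂ y).comp (O i)) (‖y‖ * M)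
      (fun i => ?_) s (fun x hx => hst x hx y hy) hx
    refine (ContinuousLinearMap.opNorm_comp_le _ _).trans ?_
    rw [innerSL_apply_norm]
    exact mul_le_mul_of_nonneg_left (hM i) (norm_nonneg _)
  have h2 : Tendsto (fun i => innerSL ℂ (O i x) y) atTop (𝓝 0) := by
    refine tendsto_zero_of_mem_closure_span (fun i => innerSL ℂ (O i x)) (M * ‖x‖)
      (fun i => ?_) t (fun y hy => ?_) hy
    · rw [innerSL_apply_norm]
      exact ((O i).le_opNorm x).trans (mul_le_mul_of_nonneg_right (hM i) (norm_nonneg _))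
    · have := (Complex.continuous_conj.tendsto _).comp (h1 y hy)
      simpa [Function.comp_def, inner_conj_symm] using this
  have := (Complex.continuous_conj.tendsto _).comp h2
  simpa [Function.comp_def, inner_conj_symm] using this

/-- Closed subspaces are weakly sequentially closed. -/
theorem mem_of_tendsto_inner [CompleteSpace K] (C : Submodule ℂ K)
    (hC : IsClosed (C : Set K)) (u : ℕ → K) (z : K) (hu : ∀ i, u i ∈ C)
    (h : ∀ y, Tendsto (fun i => inner ℂ y (u i)) atTop (𝓝 (inner ℂ y z))) : z ∈ C := by
  have : CompleteSpace C := hC.completeSpace_coe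
  rw [← Submodule.orthogonal_orthogonal C, Submodule.mem_orthogonal]
  intro y hy
  refine tendsto_nhds_unique (h y) ?_
  have : (fun i => inner ℂ y (u i)) = fun _ => 0 := by
    funext i
    exact Submodule.inner_left_of_mem_orthogonal (hu i) hy
  rw [this]
  exact tendsto_const_nhds

theorem starProjection_comm (C : Submodule ℂ K) [C.HasOrthogonalProjection] (u : K ≃ₗᵢ[ℂ] K)
    (h1 : ∀ x ∈ C, u x ∈ C) (h2 : ∀ x ∈ C, u.symm x ∈ C) (x : K) :
    C.starProjection (u x) = u (C.starProjection x) := by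
  refine Submodule.eq_starProjection_of_mem_of_inner_eq_zero
    (h1 _ (Submodule.starProjection_apply_mem _ _)) (fun w hw => ?_)
  rw [← map_sub, ← u.symm.inner_map_map, u.symm_apply_apply]
  exact Submodule.starProjection_inner_eq_zero _ _ (h2 w hw)

theorem mem_closure_span_of_map {K' : Type*} [NormedAddCommGroup K'] [InnerProductSpace ℂ K']
    (A : K →L[ℂ] K') (s : Set K) (C : Submodule ℂ K') (hC : IsClosed (C : Set K'))
    (h : ∀ x ∈ s, A x ∈ C) {x : K} (hx : x ∈ (Submodule.span ℂ s).topologicalClosure) :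
    A x ∈ C := by
  have : (Submodule.span ℂ s).topologicalClosure ≤ C.comap A.toLinearMap := by
    refine Submodule.topologicalClosure_minimal _ (Submodule.span_le.2 h) ?_
    exact hC.preimage A.continuous
  exact this hx

theorem closure_span_le (s : Set K) (C : Submodule ℂ K) (hC : IsClosed (C : Set K))
    (h : ∀ x ∈ s, x ∈ C) : (Submodule.span ℂ s).topologicalClosure ≤ C :=
  Submodule.topologicalClosure_minimal _ (Submodule.span_le.2 h) hC

theorem subset_closure_span (s : Set K) {x : K} (hx : x ∈ s) :
    x ∈ (Submodule.span ℂ s).topologicalClosure :=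
  Submodule.le_topologicalClosure _ (Submodule.subset_span hx)

end HilbertSpace

/-! ### Polar decomposition of intertwining operators. -/

section Polar

/-- An injective operator with dense range which intertwines unitary operators gives rise to a
unitary operator with the same intertwining relations (polar decomposition). -/
theorem exists_isometryEquiv_of_injective_of_denseRange {C D : Type*}
    [NormedAddCommGroup C] [InnerProductSpace ℂ C] [CompleteSpace C]
    [NormedAddCommGroup D] [InnerProductSpace ℂ D] [CompleteSpace D]
    (A : C →L[ℂ] D) (hinj : Function.Injective A) (hdense : DenseRange A) :
    ∃ V : C ≃ₗᵢ[ℂ] D, ∀ (u : C ≃ₗᵢ[ℂ] C) (w : D ≃ₗᵢ[ℂ] D), (∀ x, A (u x) = w (A x)) →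
      ∀ x, V (u x) = w (V x) := by
  set P : C →L[ℂ] C := A.adjoint ∘L A with hP
  have hPpos : (0 : C →L[ℂ] C) ≤ P := by
    rw [ContinuousLinearMap.nonneg_iff_isPositive]
    exact ContinuousLinearMap.isPositive_adjoint_comp_self A
  set B : C →L[ℂ] C := CFC.sqrt P with hB
  have hBpos : 0 ≤ B := CFC.sqrt_nonneg P
  have hBsa : ∀ x y, inner ℂ (B x) y = inner ℂ x (B y) := by
    have := (ContinuousLinearMap.nonneg_iff_isPositive _).1 hBpos
    exact this.isSymmetric
  have hBB : B * B = P := CFC.sqrt_mul_sqrt_self P hPpos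
  have hinner : ∀ x y, inner ℂ (B x) (B y) = inner ℂ (A x) (A y) := by
    intro x y
    rw [hBsa, ← mul_apply_eq_comp, hBB, hP, ContinuousLinearMap.comp_apply,
      ContinuousLinearMap.adjoint_inner_right]
  have hnorm : ∀ x, ‖A x‖ = ‖B x‖ := by
    intro x
    rw [norm_eq_sqrt_re_inner (𝕜 := ℂ), norm_eq_sqrt_re_inner (𝕜 := ℂ), hinner]
  -- The positive root `B` is self-adjoint with the same kernel as `A`, hence injective with dense
  -- range. The unitary is then the extension of `B x ↦ A x`.
  have hBdense : DenseRange B := by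
    have : (LinearMap.range B.toLinearMap).topologicalClosure = ⊤ := by
      rw [Submodule.topologicalClosure_eq_top_iff, Submodule.eq_bot_iff]
      intro y hy
      have h0 : B y = 0 := by
        refine ext_inner_left ℂ fun x => ?_
        rw [← hBsa, inner_zero_right]
        exact Submodule.inner_right_of_mem_orthogonal (LinearMap.mem_range_self _ x) hy
      apply hinj
      rw [map_zero, ← norm_eq_zero, hnorm, h0, norm_zero]
    intro x
    have hx : x ∈ (LinearMap.range B.toLinearMap).topologicalClosure := by rw [this]; trivial
    exact hx
  refine ⟨LinearEquiv.extendOfIsometry (LinearEquiv.refl ℂ C) B.toLinearMap A.toLinearMap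
    hBdense hdense hnorm, ?_⟩
  set V := LinearEquiv.extendOfIsometry (LinearEquiv.refl ℂ C) B.toLinearMap A.toLinearMap
    hBdense hdense hnorm with hV
  have hVB : ∀ x, V (B x) = A x := fun x => LinearEquiv.extendOfIsometry_eq
    (LinearEquiv.refl ℂ C) B.toLinearMap A.toLinearMap hBdense hdense hnorm x
  intro u w huw
  have hPu : Commute P (u.toLinearIsometry.toContinuousLinearMap) := by
    ext x
    refine ext_inner_right ℂ fun y => ?_
    simp only [mul_apply_eq_comp, hP, ContinuousLinearMap.comp_apply,
      ContinuousLinearMap.adjoint_inner_left]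
    change inner ℂ (A (u x)) (A y) = inner ℂ (u (A.adjoint (A x))) y
    rw [← u.symm.inner_map_map (u _), u.symm_apply_apply, ContinuousLinearMap.adjoint_inner_left,
      huw, ← w.inner_map_map (A x), ← huw (u.symm y), u.apply_symm_apply]
  -- Commutation with `A* A` passes to its square root by continuous functional calculus.
  have hBu : ∀ x, B (u x) = u (B x) := by
    have h : Commute B (u.toLinearIsometry.toContinuousLinearMap) := by
      rw [hB, CFC.sqrt_eq_cfc]
      exact hPu.cfc_nnreal _
    intro x
    exact DFunLike.congr_fun h.eq x
  intro x
  refine hBdense.induction_on (p := fun x => V (u x) = w (V x)) x ?_ ?_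
  · exact isClosed_eq (V.continuous.comp u.continuous) (w.continuous.comp V.continuous)
  · intro y
    rw [← hBu, hVB, hVB, huw]

end Polar

/-! ### Isomorphism of restrictions to invariant subspaces. -/

section Restrictions

variable {K : Type*} [NormedAddCommGroup K] [InnerProductSpace ℂ K]

/-- The restriction of a unitary operator to a reducing subspace. -/
def restrictEquiv (u : K ≃ₗᵢ[ℂ] K) (C : Submodule ℂ K) (h1 : ∀ x ∈ C, u x ∈ C)
    (h2 : ∀ x ∈ C, u.symm x ∈ C) : C ≃ₗᵢ[ℂ] C where
  toFun x := ⟨u x, h1 x x.2⟩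
  invFun x := ⟨u.symm x, h2 x x.2⟩
  map_add' x y := by ext; simp
  map_smul' c x := by ext; simp
  left_inv x := by ext; simp
  right_inv x := by ext; simp
  norm_map' x := u.norm_map x

/-- The reduction to polar decomposition: a bounded intertwiner that need be neither isometric nor
surjective is enough. `hdense` expresses density of the image of `C` in `D` as triviality of its
complement there. -/
theorem restrictionsIsomorphic_of_intertwiner [CompleteSpace K] (W : ℤ × ℤ → K ≃ₗᵢ[ℂ] K)
    (C D : Submodule ℂ K) (hCc : IsClosed (C : Set K)) (hDc : IsClosed (D : Set K))
    (hC : ∀ z, ∀ x ∈ C, W z x ∈ C) (hC' : ∀ z, ∀ x ∈ C, (W z).symm x ∈ C)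
    (hD : ∀ z, ∀ x ∈ D, W z x ∈ D) (hD' : ∀ z, ∀ x ∈ D, (W z).symm x ∈ D)
    (A : K →L[ℂ] K) (hAW : ∀ z x, A (W z x) = W z (A x)) (hAC : ∀ x ∈ C, A x ∈ D)
    (hinj : ∀ x ∈ C, A x = 0 → x = 0)
    (hdense : ∀ y ∈ D, (∀ x ∈ C, inner ℂ (A x) y = 0) → y = 0) :
    RestrictionsIsomorphic (fun z => (W z).toLinearIsometry) C D := by
  have : CompleteSpace C := hCc.completeSpace_coe
  have : CompleteSpace D := hDc.completeSpace_coe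
  set A' : C →L[ℂ] D := (A.comp C.subtypeL).codRestrict D (fun x => hAC x x.2) with hA'
  have hA'v : ∀ x : C, (A' x : K) = A x := fun x => rfl
  have hinj' : Function.Injective A' := by
    rw [injective_iff_map_eq_zero]
    intro x hx
    have h0 : A x = 0 := by rw [← hA'v, hx]; rfl
    exact Subtype.ext (hinj x x.2 h0)
  have hdense' : DenseRange A' := by
    have : (LinearMap.range A'.toLinearMap).topologicalClosure = ⊤ := by
      rw [Submodule.topologicalClosure_eq_top_iff, Submodule.eq_bot_iff]
      intro y hy
      refine Subtype.ext (hdense y y.2 fun x hx => ?_)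
      have h0 : inner ℂ (A' ⟨x, hx⟩) y = 0 := Submodule.inner_right_of_mem_orthogonal
        (LinearMap.mem_range_self A'.toLinearMap ⟨x, hx⟩) hy
      exact h0
    intro x
    have hx : x ∈ (LinearMap.range A'.toLinearMap).topologicalClosure := by rw [this]; trivial
    exact hx
  obtain ⟨V, hV⟩ := exists_isometryEquiv_of_injective_of_denseRange A' hinj' hdense'
  refine ⟨hC, V, fun z x => ?_⟩
  have := hV (restrictEquiv (W z) C (hC z) (hC' z)) (restrictEquiv (W z) D (hD z) (hD' z))
    (fun x => Subtype.ext (hAW z x)) x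
  exact congrArg Subtype.val this

theorem RestrictionsIsomorphic.refl (U : ℤ × ℤ → K →ₗᵢ[ℂ] K) (C : Submodule ℂ K)
    (hC : ∀ z, ∀ x ∈ C, U z x ∈ C) : RestrictionsIsomorphic U C C :=
  ⟨hC, LinearIsometryEquiv.refl ℂ C, fun _ _ => rfl⟩

theorem RestrictionsIsomorphic.symm {U : ℤ × ℤ → K →ₗᵢ[ℂ] K} {C D : Submodule ℂ K}
    (h : RestrictionsIsomorphic U C D) : RestrictionsIsomorphic U D C := by
  obtain ⟨hC, V, hV⟩ := h
  have hD : ∀ z, ∀ x ∈ D, U z x ∈ D := by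
    intro z x hx
    obtain ⟨y, hy⟩ := V.surjective ⟨x, hx⟩
    have := hV z y
    rw [hy] at this
    rw [← this]
    exact (V _).2
  refine ⟨hD, V.symm, fun z x => ?_⟩
  have h1 : (⟨U z x, hD z x x.2⟩ : D) = V ⟨U z (V.symm x), hC z _ (V.symm x).2⟩ := by
    apply Subtype.ext
    rw [hV z (V.symm x), V.apply_symm_apply]
  rw [h1, V.symm_apply_apply]

/-- The unitary carries a generator of `C` to a generator of `D`, so only one of the two summands
has to be proved cyclic directly. -/
theorem IsCyclicSubspace.of_restrictionsIsomorphic {U : ℤ × ℤ → K →ₗᵢ[ℂ] K} {C D : Submodule ℂ K}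
    (hU : ∀ x, U 0 x = x) (hDc : IsClosed (D : Set K)) (hcyc : IsCyclicSubspace U C) (h : RestrictionsIsomorphic U C D) : IsCyclicSubspace U D := by
  obtain ⟨v, hv⟩ := hcyc
  obtain ⟨hD, V', hV'⟩ := h.symm
  obtain ⟨hC, V, hV⟩ := h
  have hvC : v ∈ C := by
    have h0 : U 0 v ∈ C := hv ▸ subset_closure_span _ (Set.mem_range_self 0)
    rwa [hU] at h0
  have hCc : IsClosed (C : Set K) := hv ▸ Submodule.isClosed_topologicalClosure _
  refine ⟨V ⟨v, hvC⟩, le_antisymm ?_ ?_⟩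
  · refine closure_span_le _ _ hDc ?_
    rintro _ ⟨z, rfl⟩
    exact hD z _ (V _).2
  · set E := (Submodule.span ℂ (Set.range fun z => U z (V ⟨v, hvC⟩ : K))).topologicalClosure
    set S : Submodule ℂ C := E.comap (D.subtype ∘ₗ V.toLinearEquiv.toLinearMap) with hS
    have hSc : IsClosed (S : Set C) :=
      (Submodule.isClosed_topologicalClosure _).preimage
        (continuous_subtype_val.comp V.continuous)
    have hSc' : IsClosed (S.map C.subtype : Set K) :=
      hCc.isClosedEmbedding_subtypeVal.isClosedMap _ hSc
    have hCS : C ≤ S.map C.subtype := by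
      conv_lhs => rw [← hv]
      refine closure_span_le _ _ hSc' ?_
      rintro _ ⟨z, rfl⟩
      refine ⟨⟨U z v, hC z v hvC⟩, ?_, rfl⟩
      change (V ⟨U z v, hC z v hvC⟩ : K) ∈ E
      rw [hV z ⟨v, hvC⟩]
      exact subset_closure_span _ (Set.mem_range_self z)
    intro y hy
    obtain ⟨⟨x, hx⟩, hxy⟩ := V.surjective ⟨y, hy⟩
    obtain ⟨x', hx', rfl⟩ := hCS hx
    have : (V x' : K) ∈ E := hx'
    have h2 : V x' = ⟨y, hy⟩ := hxy
    rwa [h2] at this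

end Restrictions

/-! ### The Hilbert tensor square and fixed vectors of tensor operators. -/

/-- A Hilbert space `K` together with an isometric dense embedding of the algebraic tensor square
of `L`, that is, a model of the Hilbert tensor square of `L`. -/
structure TensorSquare (L K : Type*) [NormedAddCommGroup L] [InnerProductSpace ℂ L]
    [NormedAddCommGroup K] [InnerProductSpace ℂ K] where
  embedding : L ⊗[ℂ] L →ₗᵢ[ℂ] K
  denseRange : DenseRange embedding

/-- A unitary representation of `ℤ²`. -/
structure UnitaryRep (L : Type*) [NormedAddCommGroup L] [InnerProductSpace ℂ L] where
  toFun : ℤ × ℤ → L ≃ₗᵢ[ℂ] L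
  map_zero : toFun 0 = 1
  map_add : ∀ z w, toFun (z + w) = toFun z * toFun w

/-- On the subspace `H`, the operators `U^{p_i}` converge weakly to `a + b U^m`, where `a` and `b`
are positive and `a + b < 1`. -/
def HasLimitOn {L : Type*} [NormedAddCommGroup L] [InnerProductSpace ℂ L] (U : UnitaryRep L)
    (H : Submodule ℂ L) (m : ℤ × ℤ) (a b : ℝ) (p : ℕ → ℤ × ℤ) : Prop :=
  0 < a ∧ 0 < b ∧ a + b < 1 ∧ ∀ f ∈ H, ∀ g,
    Tendsto (fun i => inner ℂ g (U.toFun (p i) f)) atTop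
      (𝓝 (inner ℂ g ((a : ℂ) • f + (b : ℂ) • U.toFun m f)))

namespace TensorSquare

variable {L K : Type*} [NormedAddCommGroup L] [InnerProductSpace ℂ L]
  [NormedAddCommGroup K] [InnerProductSpace ℂ K]
  (t : TensorSquare L K)

/-- The vector of `K` representing `f ⊗ g`. -/
def tens (f g : L) : K := t.embedding (f ⊗ₜ[ℂ] g)

theorem inner_tens (f g f' g' : L) :
    inner ℂ (t.tens f g) (t.tens f' g') = inner ℂ f f' * inner ℂ g g' := by
  simp [tens]

theorem tens_add_left (f f' g : L) : t.tens (f + f') g = t.tens f g + t.tens f' g := by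
  simp [tens, TensorProduct.add_tmul]

theorem tens_add_right (f g g' : L) : t.tens f (g + g') = t.tens f g + t.tens f g' := by
  simp [tens, TensorProduct.tmul_add]

theorem tens_smul_left (c : ℂ) (f g : L) : t.tens (c • f) g = c • t.tens f g := by
  simp [tens, ← TensorProduct.smul_tmul']

theorem tens_smul_right (c : ℂ) (f g : L) : t.tens f (c • g) = c • t.tens f g := by
  simp [tens]

theorem norm_tens (f g : L) : ‖t.tens f g‖ = ‖f‖ * ‖g‖ := by simp [tens]

/-- `f ↦ f ⊗ g` as a continuous linear map. -/
def tensLeft (g : L) : L →L[ℂ] K :=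
  LinearMap.mkContinuous
    { toFun := fun f => t.tens f g
      map_add' := fun f f' => t.tens_add_left f f' g
      map_smul' := fun c f => t.tens_smul_left c f g } ‖g‖
    (fun f => by simp [norm_tens, mul_comm])

/-- `g ↦ f ⊗ g` as a continuous linear map. -/
def tensRight (f : L) : L →L[ℂ] K :=
  LinearMap.mkContinuous
    { toFun := fun g => t.tens f g
      map_add' := fun g g' => t.tens_add_right f g g'
      map_smul' := fun c g => t.tens_smul_right c f g } ‖f‖
    (fun g => by simp [norm_tens])

theorem tensLeft_apply (f g : L) : t.tensLeft g f = t.tens f g := rfl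

/-- The closed span of the vectors `f ⊗ g` with `f ∈ M`, `g ∈ N`. -/
def prod (M N : Submodule ℂ L) : Submodule ℂ K :=
  (Submodule.span ℂ (Set.image2 t.tens M N)).topologicalClosure

theorem isClosed_prod (M N : Submodule ℂ L) : IsClosed (t.prod M N : Set K) :=
  Submodule.isClosed_topologicalClosure _

instance [CompleteSpace K] (M N : Submodule ℂ L) : CompleteSpace (t.prod M N) :=
  (t.isClosed_prod M N).completeSpace_coe

theorem tens_mem_prod {M N : Submodule ℂ L} {f g : L} (hf : f ∈ M) (hg : g ∈ N) :
    t.tens f g ∈ t.prod M N :=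
  subset_closure_span _ ⟨f, hf, g, hg, rfl⟩

theorem prod_mono {M N M' N' : Submodule ℂ L} (h : M ≤ M') (h' : N ≤ N') :
    t.prod M N ≤ t.prod M' N' := by
  refine closure_span_le _ _ (t.isClosed_prod _ _) ?_
  rintro _ ⟨f, hf, g, hg, rfl⟩
  exact t.tens_mem_prod (h hf) (h' hg)

theorem map_mem_of_forall_tens {M N : Submodule ℂ L} (A : K →L[ℂ] K) {C : Submodule ℂ K}
    (hC : IsClosed (C : Set K)) (h : ∀ f ∈ M, ∀ g ∈ N, A (t.tens f g) ∈ C) {x : K}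
    (hx : x ∈ t.prod M N) : A x ∈ C := by
  refine mem_closure_span_of_map A _ C hC ?_ hx
  rintro _ ⟨f, hf, g, hg, rfl⟩
  exact h f hf g hg

/-- It suffices to consider tensor products of vectors from total subsets. -/
theorem map_mem_of_forall_tens_of_span {s s' : Set L} (A : K →L[ℂ] K) {C : Submodule ℂ K}
    (hC : IsClosed (C : Set K)) (h : ∀ f ∈ s, ∀ g ∈ s', A (t.tens f g) ∈ C) {x : K}
    (hx : x ∈ t.prod (Submodule.span ℂ s).topologicalClosure
      (Submodule.span ℂ s').topologicalClosure) : A x ∈ C := by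
  refine t.map_mem_of_forall_tens A hC (fun f hf g hg => ?_) hx
  refine mem_closure_span_of_map (A.comp (t.tensLeft g)) s C hC (fun f hf => ?_) hf
  exact mem_closure_span_of_map (A.comp (t.tensRight f)) s' C hC (fun g hg => h f hf g hg) hg

theorem prod_top : t.prod ⊤ ⊤ = ⊤ := by
  rw [prod, ← top_le_iff]
  have h1 : LinearMap.range t.embedding.toLinearMap ≤
      Submodule.span ℂ (Set.image2 t.tens ((⊤ : Submodule ℂ L) : Set L)
        ((⊤ : Submodule ℂ L) : Set L)) := by
    rintro _ ⟨x, rfl⟩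
    induction x using TensorProduct.induction_on with
    | zero => simp
    | tmul f g => exact Submodule.subset_span ⟨f, trivial, g, trivial, rfl⟩
    | add x y hx hy => rw [_root_.map_add]; exact Submodule.add_mem _ hx hy
  intro x _
  exact closure_mono h1 (t.denseRange x)

theorem ext_of_tens (A B : K →L[ℂ] K) (h : ∀ f g, A (t.tens f g) = B (t.tens f g)) (x : K) :
    A x = B x := by
  have hx : x ∈ t.prod ⊤ ⊤ := by rw [prod_top]; trivial
  have := t.map_mem_of_forall_tens (A - B) (C := ⊥) (by simp)
    (fun f _ g _ => by simp [h f g]) hx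
  simpa [sub_eq_zero] using this

theorem ext_equiv (A B : K ≃ₗᵢ[ℂ] K) (h : ∀ f g, A (t.tens f g) = B (t.tens f g)) (x : K) :
    A x = B x :=
  t.ext_of_tens A.toLinearIsometry.toContinuousLinearMap B.toLinearIsometry.toContinuousLinearMap
    h x

theorem prod_isOrtho {M N M' N' : Submodule ℂ L} (h : M ⟂ M' ∨ N ⟂ N') :
    t.prod M N ⟂ t.prod M' N' := by
  have h0 : ∀ f ∈ M, ∀ g ∈ N, ∀ f' ∈ M', ∀ g' ∈ N',
      inner ℂ (t.tens f' g') (t.tens f g) = 0 := by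
    intro f hf g hg f' hf' g' hg'
    rw [inner_tens]
    rcases h with h | h
    · rw [Submodule.isOrtho_iff_inner_eq.1 h.symm f' hf' f hf, zero_mul]
    · rw [Submodule.isOrtho_iff_inner_eq.1 h.symm g' hg' g hg, mul_zero]
  have h1 : ∀ f ∈ M, ∀ g ∈ N, t.tens f g ∈ (t.prod M' N')ᗮ := by
    intro f hf g hg
    have : t.prod M' N' ≤ (ℂ ∙ t.tens f g)ᗮ := by
      refine closure_span_le _ _ (Submodule.isClosed_orthogonal _) ?_
      rintro _ ⟨f', hf', g', hg', rfl⟩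
      rw [Submodule.mem_orthogonal_singleton_iff_inner_left]
      exact h0 f hf g hg f' hf' g' hg'
    rw [Submodule.mem_orthogonal]
    intro u hu
    exact (Submodule.mem_orthogonal_singleton_iff_inner_left.1 (this hu))
  refine closure_span_le _ _ (Submodule.isClosed_orthogonal _) ?_
  rintro _ ⟨f, hf, g, hg, rfl⟩
  exact h1 f hf g hg

theorem eq_zero_of_orthogonal_prods [CompleteSpace K] (E : Submodule ℂ L)
    [E.HasOrthogonalProjection] {x : K}
    (h1 : x ∈ (t.prod E E)ᗮ) (h2 : x ∈ (t.prod Eᗮ E)ᗮ) (h3 : x ∈ (t.prod E Eᗮ)ᗮ)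
    (h4 : x ∈ (t.prod Eᗮ Eᗮ)ᗮ) : x = 0 := by
  have h : t.prod ⊤ ⊤ ≤ (ℂ ∙ x)ᗮ := by
    refine closure_span_le _ _ (Submodule.isClosed_orthogonal _) ?_
    rintro _ ⟨f, -, g, -, rfl⟩
    rw [Submodule.mem_orthogonal_singleton_iff_inner_left]
    rw [← E.starProjection_add_starProjection_orthogonal f,
      ← E.starProjection_add_starProjection_orthogonal g]
    simp only [tens_add_left, tens_add_right, inner_add_left]
    have hm := fun f : L => Submodule.starProjection_apply_mem E f
    have hm' := fun f : L => Submodule.starProjection_apply_mem Eᗮ f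
    rw [Submodule.inner_right_of_mem_orthogonal (t.tens_mem_prod (hm f) (hm g)) h1,
      Submodule.inner_right_of_mem_orthogonal (t.tens_mem_prod (hm' f) (hm g)) h2,
      Submodule.inner_right_of_mem_orthogonal (t.tens_mem_prod (hm f) (hm' g)) h3,
      Submodule.inner_right_of_mem_orthogonal (t.tens_mem_prod (hm' f) (hm' g)) h4]
    simp
  rw [prod_top] at h
  have := Submodule.mem_orthogonal_singleton_iff_inner_left.1 (h (Submodule.mem_top (x := x)))
  simpa using this

variable [CompleteSpace K]

/-- The unitary operator `u ⊗ v`. -/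
def map (u v : L ≃ₗᵢ[ℂ] L) : K ≃ₗᵢ[ℂ] K :=
  LinearEquiv.extendOfIsometry (TensorProduct.congrIsometry u v).toLinearEquiv
    t.embedding.toLinearMap t.embedding.toLinearMap t.denseRange t.denseRange
    (fun x => by
      change ‖t.embedding (TensorProduct.congrIsometry u v x)‖ = ‖t.embedding x‖
      rw [t.embedding.norm_map, t.embedding.norm_map, LinearIsometryEquiv.norm_map])

theorem map_tens (u v : L ≃ₗᵢ[ℂ] L) (f g : L) : t.map u v (t.tens f g) = t.tens (u f) (v g) := by
  refine (LinearEquiv.extendOfIsometry_eq _ _ _ _ _ _ _).trans ?_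
  simp [tens]

/-- The flip `f ⊗ g ↦ g ⊗ f`. -/
def swap : K ≃ₗᵢ[ℂ] K :=
  LinearEquiv.extendOfIsometry (TensorProduct.commIsometry ℂ L L).toLinearEquiv
    t.embedding.toLinearMap t.embedding.toLinearMap t.denseRange t.denseRange
    (fun x => by
      change ‖t.embedding (TensorProduct.commIsometry ℂ L L x)‖ = ‖t.embedding x‖
      rw [t.embedding.norm_map, t.embedding.norm_map, LinearIsometryEquiv.norm_map])

theorem swap_tens (f g : L) : t.swap (t.tens f g) = t.tens g f := by
  refine (LinearEquiv.extendOfIsometry_eq _ _ _ _ _ _ _).trans ?_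
  simp [tens]

theorem map_map (u v u' v' : L ≃ₗᵢ[ℂ] L) (x : K) :
    t.map u v (t.map u' v' x) = t.map (u * u') (v * v') x :=
  t.ext_equiv (t.map u v * t.map u' v') _ (fun f g => by
    simp [map_tens]) x

theorem map_one_one (x : K) : t.map 1 1 x = x :=
  t.ext_equiv (t.map 1 1) 1 (fun f g => by simp [map_tens]) x

theorem swap_swap (x : K) : t.swap (t.swap x) = x :=
  t.ext_equiv (t.swap * t.swap) 1 (fun f g => by simp [swap_tens]) x

theorem swap_map (u v : L ≃ₗᵢ[ℂ] L) (x : K) : t.swap (t.map u v x) = t.map v u (t.swap x) :=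
  t.ext_equiv (t.swap * t.map u v) (t.map v u * t.swap)
    (fun f g => by simp [swap_tens, map_tens]) x

theorem map_mem_prod {M N M' N' : Submodule ℂ L} (u v : L ≃ₗᵢ[ℂ] L) (hu : ∀ f ∈ M, u f ∈ M')
    (hv : ∀ g ∈ N, v g ∈ N') {x : K} (hx : x ∈ t.prod M N) : t.map u v x ∈ t.prod M' N' :=
  t.map_mem_of_forall_tens (t.map u v).toLinearIsometry.toContinuousLinearMap
    (t.isClosed_prod _ _)
    (fun f hf g hg => by
      change t.map u v (t.tens f g) ∈ _
      rw [map_tens]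
      exact t.tens_mem_prod (hu f hf) (hv g hg)) hx

theorem swap_mem_prod {M N : Submodule ℂ L} {x : K} (hx : x ∈ t.prod M N) :
    t.swap x ∈ t.prod N M :=
  t.map_mem_of_forall_tens t.swap.toLinearIsometry.toContinuousLinearMap
    (t.isClosed_prod _ _)
    (fun f hf g hg => by
      change t.swap (t.tens f g) ∈ _
      rw [swap_tens]
      exact t.tens_mem_prod hg hf) hx

/-- If the operators `U^p` have the weak limit `a + b U^m` with `a + b < 1` on `H`, then
no family `v_p ⊗ U^p` has a nonzero common fixed vector in `L ⊗ H`. -/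
theorem eq_zero_of_map_eq_self (U : UnitaryRep L) {H : Submodule ℂ L} {m : ℤ × ℤ} {a b : ℝ}
    {p : ℕ → ℤ × ℤ} (hlim : HasLimitOn U H m a b p) (v : ℤ × ℤ → L ≃ₗᵢ[ℂ] L) {F : K}
    (hF : F ∈ t.prod ⊤ H) (hfix : ∀ q, t.map (v q) (U.toFun q) F = F) : F = 0 := by
  obtain ⟨ha, hb, hab, hlim⟩ := hlim
  -- `N` is 1 ⊗ (a + bU^m), a strict contraction. It replaces 1 ⊗ U^p in the limit while the first
  -- factor v_p, which need not converge, is left alone.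
  set N : K →L[ℂ] K := (a : ℂ) • ContinuousLinearMap.id ℂ K +
    (b : ℂ) • (t.map 1 (U.toFun m)).toLinearIsometry.toContinuousLinearMap with hN
  have hNapp : ∀ x, N x = (a : ℂ) • x + (b : ℂ) • t.map 1 (U.toFun m) x := fun x => rfl
  have hNle : ∀ x, ‖N x‖ ≤ (a + b) * ‖x‖ := by
    intro x
    rw [hNapp]
    refine (norm_add_le _ _).trans ?_
    rw [norm_smul, norm_smul, LinearIsometryEquiv.norm_map, Complex.norm_real, Complex.norm_real,
      Real.norm_of_nonneg ha.le, Real.norm_of_nonneg hb.le, add_mul]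
  set O : ℕ → K →L[ℂ] K := fun i =>
    (t.map (v (p i)) (U.toFun (p i))).toLinearIsometry.toContinuousLinearMap -
      (t.map (v (p i)) 1).toLinearIsometry.toContinuousLinearMap.comp N with hO
  have hOapp : ∀ i x, O i x = t.map (v (p i)) (U.toFun (p i)) x - t.map (v (p i)) 1 (N x) :=
    fun i x => rfl
  have hObd : ∀ i, ‖O i‖ ≤ 2 := by
    intro i
    refine ContinuousLinearMap.opNorm_le_bound _ (by norm_num) fun x => ?_
    rw [hOapp]
    refine (norm_sub_le _ _).trans ?_
    rw [LinearIsometryEquiv.norm_map, LinearIsometryEquiv.norm_map]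
    nlinarith [hNle x, norm_nonneg x]
  -- On pure tensors the inner product factors into a bounded term containing v_p and a term that
  -- tends to zero by the weak limit.
  have hlimO : Tendsto (fun i => inner ℂ F (O i F)) atTop (𝓝 0) := by
    refine tendsto_inner_zero_of_mem_closure_span O 2 hObd
      (Set.image2 t.tens ((⊤ : Submodule ℂ L) : Set L) H)
      (Set.image2 t.tens ((⊤ : Submodule ℂ L) : Set L) H) ?_ hF hF
    rintro _ ⟨f, -, g, hg, rfl⟩ _ ⟨f', -, g', -, rfl⟩
    have hcalc : ∀ i, inner ℂ (t.tens f' g') (O i (t.tens f g)) =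
        inner ℂ f' (v (p i) f) * (inner ℂ g' (U.toFun (p i) g) -
          inner ℂ g' ((a : ℂ) • g + (b : ℂ) • U.toFun m g)) := by
      intro i
      rw [hOapp, hNapp, map_tens, map_tens, ← tens_smul_right, ← tens_smul_right,
        LinearIsometryEquiv.coe_one, id_eq, ← tens_add_right, map_tens, inner_sub_right, inner_tens,
        inner_tens, LinearIsometryEquiv.coe_one, id_eq, mul_sub]
    simp only [hcalc]
    have h0 := (hlim g hg g').sub_const (inner ℂ g' ((a : ℂ) • g + (b : ℂ) • U.toFun m g))
    rw [sub_self] at h0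
    refine squeeze_zero_norm (a := fun i => (‖f'‖ * ‖f‖) * ‖inner ℂ g' (U.toFun (p i) g) -
          inner ℂ g' ((a : ℂ) • g + (b : ℂ) • U.toFun m g)‖) (fun i => ?_) ?_
    · rw [norm_mul]
      refine mul_le_mul_of_nonneg_right ?_ (norm_nonneg _)
      refine (norm_inner_le_norm _ _).trans ?_
      rw [LinearIsometryEquiv.norm_map]
    · simpa using h0.norm.const_mul (‖f'‖ * ‖f‖)
  -- A fixed vector makes the first term of `O i` contribute `‖F‖ ^ 2`, and the second at most `(a +
  -- b) * ‖F‖ ^ 2`; this bound survives in the limit.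
  have hle : ∀ i, (1 - (a + b)) * ‖F‖ ^ 2 ≤ ‖inner ℂ F (O i F)‖ := by
    intro i
    rw [hOapp, hfix, inner_sub_right]
    have h1 : ‖inner ℂ F (t.map (v (p i)) 1 (N F))‖ ≤ (a + b) * ‖F‖ ^ 2 := by
      refine (norm_inner_le_norm _ _).trans ?_
      rw [LinearIsometryEquiv.norm_map]
      nlinarith [hNle F, norm_nonneg F]
    have h2 : ‖(inner ℂ F F : ℂ)‖ = ‖F‖ ^ 2 := by
      rw [inner_self_eq_norm_sq_to_K]; simp
    have h3 := norm_sub_norm_le (inner ℂ F F) (inner ℂ F (t.map (v (p i)) 1 (N F)))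
    rw [h2] at h3
    linarith
  have := ge_of_tendsto' hlimO.norm hle
  rw [norm_zero] at this
  have h4 : ‖F‖ ^ 2 ≤ 0 := by nlinarith [sq_nonneg ‖F‖]
  have h5 : ‖F‖ = 0 := by nlinarith [norm_nonneg F]
  exact norm_eq_zero.1 h5

end TensorSquare

/-! ### Möbius transforms of unitaries and reduction to generators. -/

/-- The Cayley type transform `(A - u)(1 - A u)⁻¹` of a unitary operator is unitary. -/
theorem exists_moebius {L : Type*} [NormedAddCommGroup L] [InnerProductSpace ℂ L]
    [CompleteSpace L] (u : L ≃ₗᵢ[ℂ] L) (A : ℝ) (hA : 1 < A) :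
    ∃ v : L ≃ₗᵢ[ℂ] L, ∀ x, v (x - (A : ℂ) • u x) = (A : ℂ) • x - u x := by
  have key : ∀ w : L ≃ₗᵢ[ℂ] L, Function.Bijective
      ((A : ℂ) • LinearMap.id - w.toLinearEquiv.toLinearMap : L →ₗ[ℂ] L) := by
    intro w
    rcases subsingleton_or_nontrivial L with hL | hL
    · exact ⟨fun _ _ _ => Subsingleton.elim _ _, fun y => ⟨0, Subsingleton.elim _ _⟩⟩
    have hmem : (A : ℂ) ∈ resolventSet ℂ (w.toLinearIsometry.toContinuousLinearMap) := by
      refine spectrum.mem_resolventSet_of_norm_lt ?_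
      refine (LinearIsometry.norm_toContinuousLinearMap_le _).trans_lt ?_
      rwa [Complex.norm_real, Real.norm_of_nonneg (by linarith)]
    rw [spectrum.mem_resolventSet_iff, ContinuousLinearMap.isUnit_iff_bijective] at hmem
    convert hmem using 1
    ext x
    simp [Algebra.algebraMap_eq_smul_one]
  -- Here 1 - Au = -u(A - u⁻¹), so `key` applied to the inverse of `u` suffices.
  have hsurj : Function.Bijective (LinearMap.id - (A : ℂ) • u.toLinearEquiv.toLinearMap
      : L →ₗ[ℂ] L) := by
    have h := u.bijective.comp (key u.symm)
    have h' := (Equiv.neg L).bijective.comp h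
    convert h' using 1
    ext x
    change x - (A : ℂ) • u x = -u ((A : ℂ) • x - u.symm x)
    rw [map_sub, _root_.map_smul, u.apply_symm_apply, neg_sub]
  set P := LinearEquiv.ofBijective _ hsurj with hP
  set N := LinearEquiv.ofBijective _ (key u) with hN
  have hPa : ∀ x, P x = x - (A : ℂ) • u x := fun x => rfl
  have hNa : ∀ x, N x = (A : ℂ) • x - u x := fun x => rfl
  -- Since `A` is real, both squared norms equal (1 + A²)‖x‖² - 2A Re⟨x, ux⟩.
  have hnorm : ∀ x, ‖N x‖ = ‖P x‖ := by
    intro x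
    rw [hPa, hNa, ← sq_eq_sq₀ (norm_nonneg _) (norm_nonneg _), norm_sub_sq (𝕜 := ℂ),
      norm_sub_sq (𝕜 := ℂ), norm_smul, norm_smul, u.norm_map, inner_smul_left, inner_smul_right]
    simp
    ring
  refine ⟨⟨P.symm.trans N, fun x => ?_⟩, fun x => ?_⟩
  · rw [LinearEquiv.trans_apply, hnorm, P.apply_symm_apply]
  · change N (P.symm (x - (A : ℂ) • u x)) = _
    rw [← hPa, P.symm_apply_apply, hNa]

theorem UnitaryRep.toFun_eq {L : Type*} [NormedAddCommGroup L] [InnerProductSpace ℂ L]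
    (U : UnitaryRep L) (p : ℤ × ℤ) :
    U.toFun p = U.toFun (1, 0) ^ p.1 * U.toFun (0, 1) ^ p.2 := by
  let φ : Multiplicative (ℤ × ℤ) →* (L ≃ₗᵢ[ℂ] L) :=
    { toFun := fun z => U.toFun z.toAdd
      map_one' := U.map_zero
      map_mul' := fun z w => U.map_add _ _ }
  have h : Multiplicative.ofAdd p = Multiplicative.ofAdd ((1, 0) : ℤ × ℤ) ^ p.1 *
      Multiplicative.ofAdd ((0, 1) : ℤ × ℤ) ^ p.2 := by
    rw [← ofAdd_zsmul, ← ofAdd_zsmul, ← ofAdd_add]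
    congr 1
    ext <;> simp
  have := congrArg φ h
  rwa [_root_.map_mul, map_zpow, map_zpow] at this

namespace TensorSquare

variable {L K : Type*} [NormedAddCommGroup L] [InnerProductSpace ℂ L]
  [NormedAddCommGroup K] [InnerProductSpace ℂ K] [CompleteSpace K]
  (t : TensorSquare L K) (U : UnitaryRep L)

/-- `(u, v) ↦ u ⊗ v` as a homomorphism. -/
def mapHom : (L ≃ₗᵢ[ℂ] L) × (L ≃ₗᵢ[ℂ] L) →* (K ≃ₗᵢ[ℂ] K) where
  toFun p := t.map p.1 p.2
  map_one' := LinearIsometryEquiv.ext t.map_one_one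
  map_mul' _ _ := LinearIsometryEquiv.ext fun x => (t.map_map _ _ _ _ x).symm

/-- The unitaries fixing `F` form a group, so two generators give all `q`. The operators `v₁` and
`v₂` need not commute, because `eq_zero_of_map_eq_self` accepts an arbitrary family in the first
factor. -/
theorem eq_zero_of_fixed_generators {H : Submodule ℂ L} {m : ℤ × ℤ} {a b : ℝ}
    {p : ℕ → ℤ × ℤ} (hlim : HasLimitOn U H m a b p) (v₁ v₂ : L ≃ₗᵢ[ℂ] L) {F : K}
    (hF : F ∈ t.prod ⊤ H) (h₁ : t.map v₁ (U.toFun (1, 0)) F = F)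
    (h₂ : t.map v₂ (U.toFun (0, 1)) F = F) : F = 0 := by
  refine t.eq_zero_of_map_eq_self U hlim (fun q => v₁ ^ q.1 * v₂ ^ q.2) hF fun q => ?_
  let St : Subgroup (K ≃ₗᵢ[ℂ] K) :=
    { carrier := {g | g F = F}
      one_mem' := rfl
      mul_mem' := fun {g g'} hg hg' => by
        change g (g' F) = F
        rw [show g' F = F from hg', show g F = F from hg]
      inv_mem' := fun {g} hg => by
        change g.symm F = F
        conv_lhs => rw [← show g F = F from hg]
        exact g.symm_apply_apply F }
  have hm1 : t.mapHom (v₁, U.toFun (1, 0)) ∈ St := h₁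
  have hm2 : t.mapHom (v₂, U.toFun (0, 1)) ∈ St := h₂
  have := St.mul_mem (St.zpow_mem hm1 q.1) (St.zpow_mem hm2 q.2)
  rw [← map_zpow, ← map_zpow, ← _root_.map_mul] at this
  have h3 : t.map (v₁ ^ q.1 * v₂ ^ q.2)
    (U.toFun (1, 0) ^ q.1 * U.toFun (0, 1) ^ q.2) F = F := this
  rwa [← U.toFun_eq] at h3

/-! ### The diagonal action and its weak limits. -/

/-- The operator `U^z ⊗ U^w`. -/
def bi (z w : ℤ × ℤ) : K ≃ₗᵢ[ℂ] K := t.map (U.toFun z) (U.toFun w)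

theorem bi_tens (z w : ℤ × ℤ) (f g : L) :
    t.bi U z w (t.tens f g) = t.tens (U.toFun z f) (U.toFun w g) := t.map_tens _ _ f g

theorem bi_bi (z w z' w' : ℤ × ℤ) (x : K) :
    t.bi U z w (t.bi U z' w' x) = t.bi U (z + z') (w + w') x := by
  rw [bi, bi, map_map, ← U.map_add, ← U.map_add, bi]

theorem bi_zero (x : K) : t.bi U 0 0 x = x := by
  rw [bi, U.map_zero, map_one_one]

theorem bi_symm (z w : ℤ × ℤ) (x : K) : (t.bi U z w).symm x = t.bi U (-z) (-w) x := by
  rw [LinearIsometryEquiv.symm_apply_eq, bi_bi, add_neg_cancel, add_neg_cancel, bi_zero]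

theorem swap_bi (z w : ℤ × ℤ) (x : K) : t.swap (t.bi U z w x) = t.bi U w z (t.swap x) :=
  t.swap_map _ _ x

theorem bi_mem_prod {M N : Submodule ℂ L} (hM : ∀ z, ∀ f ∈ M, U.toFun z f ∈ M)
    (hN : ∀ z, ∀ f ∈ N, U.toFun z f ∈ N) (z w : ℤ × ℤ) {x : K} (hx : x ∈ t.prod M N) :
    t.bi U z w x ∈ t.prod M N :=
  t.map_mem_prod _ _ (hM z) (hN w) hx

/-- Weak convergence on the factors implies weak convergence on the product. -/
theorem tendsto_inner_bi {M N : Submodule ℂ L} (p : ℕ → ℤ × ℤ) (α β : L → L)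
    (hα : ∀ f ∈ M, ∀ g, Tendsto (fun i => inner ℂ g (U.toFun (p i) f)) atTop
      (𝓝 (inner ℂ g (α f))))
    (hβ : ∀ f ∈ N, ∀ g, Tendsto (fun i => inner ℂ g (U.toFun (p i) f)) atTop
      (𝓝 (inner ℂ g (β f))))
    (A : K →L[ℂ] K) (hA : ∀ f ∈ M, ∀ g ∈ N, A (t.tens f g) = t.tens (α f) (β g))
    {x : K} (hx : x ∈ t.prod M N) (y : K) :
    Tendsto (fun i => inner ℂ y (t.bi U (p i) (p i) x)) atTop (𝓝 (inner ℂ y (A x))) := by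
  set O : ℕ → K →L[ℂ] K := fun i =>
    (t.bi U (p i) (p i)).toLinearIsometry.toContinuousLinearMap - A with hO
  have hOapp : ∀ i x, O i x = t.bi U (p i) (p i) x - A x := fun i x => rfl
  have hObd : ∀ i, ‖O i‖ ≤ 1 + ‖A‖ := fun i =>
    (norm_sub_le _ _).trans
      (add_le_add_left (LinearIsometry.norm_toContinuousLinearMap_le _) _)
  have hy : y ∈ t.prod ⊤ ⊤ := by rw [prod_top]; trivial
  have h0 : Tendsto (fun i => inner ℂ y (O i x)) atTop (𝓝 0) := by
    refine tendsto_inner_zero_of_mem_closure_span O _ hObd _ _ ?_ hx hy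
    rintro _ ⟨f, hf, g, hg, rfl⟩ _ ⟨f', -, g', -, rfl⟩
    have h1 := (((hα f hf f').mul (hβ g hg g')).sub_const
      (inner ℂ f' (α f) * inner ℂ g' (β g)))
    rw [sub_self] at h1
    refine h1.congr fun i => ?_
    rw [hOapp, bi_tens, hA f hf g hg, inner_sub_right, inner_tens, inner_tens]
  have h1 := h0.add_const (inner ℂ y (A x))
  rw [zero_add] at h1
  refine h1.congr fun i => ?_
  rw [hOapp, inner_sub_right, sub_add_cancel]

/-- The operator `U^m ⊗ 1 + 1 ⊗ U^m`. -/
def symSum (m : ℤ × ℤ) (x : K) : K := t.bi U m 0 x + t.bi U 0 m x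

/-- The limit of the diagonal action on `H ⊗ H`. -/
theorem tendsto_inner_bi_prod {H : Submodule ℂ L} {m : ℤ × ℤ} {a b : ℝ}
    {p : ℕ → ℤ × ℤ} (hlim : HasLimitOn U H m a b p) {x : K} (hx : x ∈ t.prod H H) (y : K) :
    Tendsto (fun i => inner ℂ y (t.bi U (p i) (p i) x)) atTop
      (𝓝 (inner ℂ y (((a * a : ℝ) : ℂ) • x + ((a * b : ℝ) : ℂ) • t.symSum U m x +
        ((b * b : ℝ) : ℂ) • t.bi U m m x))) := by
  obtain ⟨-, -, -, h⟩ := hlim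
  refine t.tendsto_inner_bi U p (fun f => (a : ℂ) • f + (b : ℂ) • U.toFun m f)
    (fun f => (a : ℂ) • f + (b : ℂ) • U.toFun m f) h h
    (((a * a : ℝ) : ℂ) • ContinuousLinearMap.id ℂ K + ((a * b : ℝ) : ℂ) •
      ((t.bi U m 0).toLinearIsometry.toContinuousLinearMap +
        (t.bi U 0 m).toLinearIsometry.toContinuousLinearMap) +
      ((b * b : ℝ) : ℂ) • (t.bi U m m).toLinearIsometry.toContinuousLinearMap) ?_ hx y
  intro f _ g _
  change ((a * a : ℝ) : ℂ) • t.tens f g + ((a * b : ℝ) : ℂ) • (t.bi U m 0 (t.tens f g) +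
    t.bi U 0 m (t.tens f g)) + ((b * b : ℝ) : ℂ) • t.bi U m m (t.tens f g) = _
  simp only [bi_tens, tens_add_left, tens_add_right, tens_smul_left, tens_smul_right, U.map_zero,
    LinearIsometryEquiv.coe_one, id_eq]
  push_cast
  module

/-- The limit of the diagonal action on `H ⊗ E` for a space `E` of invariant vectors. -/
theorem tendsto_inner_bi_prod_invariant {H E : Submodule ℂ L} {m : ℤ × ℤ} {a b : ℝ}
    {p : ℕ → ℤ × ℤ} (hlim : HasLimitOn U H m a b p) (hE : ∀ z, ∀ f ∈ E, U.toFun z f = f)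
    {x : K} (hx : x ∈ t.prod H E) (y : K) :
    Tendsto (fun i => inner ℂ y (t.bi U (p i) (p i) x)) atTop
      (𝓝 (inner ℂ y ((a : ℂ) • x + (b : ℂ) • t.bi U m m x))) := by
  obtain ⟨-, -, -, h⟩ := hlim
  refine t.tendsto_inner_bi U p (fun f => (a : ℂ) • f + (b : ℂ) • U.toFun m f)
    (fun f => f) h (fun f hf g => ?_)
    ((a : ℂ) • ContinuousLinearMap.id ℂ K +
      (b : ℂ) • (t.bi U m m).toLinearIsometry.toContinuousLinearMap) ?_ hx y
  · simp only [hE _ f hf]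
    exact tendsto_const_nhds
  · intro f _ g hg
    change (a : ℂ) • t.tens f g + (b : ℂ) • t.bi U m m (t.tens f g) = _
    rw [bi_tens, hE _ g hg, tens_add_left, tens_smul_left, tens_smul_left]

/-- The weak limit of U^p ⊗ U^p applied to `x` stays in `C`. Its terms in `x` and (U^m ⊗ U^m)x
already lie in `C`, and the remaining one has the nonzero coefficient ab. -/
theorem symSum_mem_of_hasLimitOn {H : Submodule ℂ L} {C : Submodule ℂ K}
    (hinv : ∀ z, ∀ x ∈ C, t.bi U z z x ∈ C) (hC : IsClosed (C : Set K))
    (hCH : C ≤ t.prod H H) {m : ℤ × ℤ} {a b : ℝ} {p : ℕ → ℤ × ℤ} (hlim : HasLimitOn U H m a b p)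
    {x : K} (hx : x ∈ C) : t.symSum U m x ∈ C := by
  have h := mem_of_tendsto_inner C hC _ _ (fun i => hinv (p i) x hx)
    (t.tendsto_inner_bi_prod U hlim (hCH hx))
  have h1 := C.sub_mem (C.sub_mem h (C.smul_mem ((a * a : ℝ) : ℂ) hx))
    (C.smul_mem ((b * b : ℝ) : ℂ) (hinv m x hx))
  have hab : ((a * b : ℝ) : ℂ) ≠ 0 := by
    exact_mod_cast (mul_pos hlim.1 hlim.2.1).ne'
  have h2 : ((a * b : ℝ) : ℂ) • t.symSum U m x ∈ C := by
    convert h1 using 1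
    module
  exact (C.smul_mem_iff hab).1 h2

end TensorSquare

/-! ### Symmetric sums, and the relation forced by an intertwiner. -/

/-- A unitary relation between `F - B S F` and `A F - S F` forces `A = B` if `A + B > 2`. -/
theorem coefficient_eq {K : Type*} [NormedAddCommGroup K] [InnerProductSpace ℂ K] {A B : ℝ} (hAB : 2 < A + B) {F : K}
    (hF : F ≠ 0) (R S : K ≃ₗᵢ[ℂ] K)
    (h : R (F - (B : ℂ) • S F) = (A : ℂ) • F - S F) : A = B := by
  have hn := congrArg norm h
  rw [R.norm_map, ← sq_eq_sq₀ (norm_nonneg _) (norm_nonneg _), norm_sub_sq (𝕜 := ℂ),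
      norm_sub_sq (𝕜 := ℂ), norm_smul, norm_smul, S.norm_map, inner_smul_left,
      inner_smul_right] at hn
  have hre : RCLike.re (inner ℂ F (S F)) ≤ ‖F‖ * ‖F‖ := by
    have := re_inner_le_norm (𝕜 := ℂ) F (S F)
    rwa [S.norm_map] at this
  simp at hn hre
  have hpos : 0 < ‖F‖ := norm_pos_iff.2 hF
  by_contra hne
  -- This is the difference of the two squared norms. The second factor is positive because Re⟨F,
  -- SF⟩ ≤ ‖F‖² and A + B > 2.
  have h1 : (A - B) * ((A + B) * ‖F‖ ^ 2 - 2 * (inner ℂ F (S F)).re) = 0 := by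
    rw [mul_pow, mul_pow, sq_abs, sq_abs] at hn
    linarith
  rcases mul_eq_zero.1 h1 with h2 | h2
  · exact hne (sub_eq_zero.1 h2)
  · nlinarith [mul_pos hpos hpos]

namespace TensorSquare

variable {L K : Type*} [NormedAddCommGroup L] [InnerProductSpace ℂ L]
  [NormedAddCommGroup K] [InnerProductSpace ℂ K] [CompleteSpace K]
  (t : TensorSquare L K) (U : UnitaryRep L)

/-- The operator form of s^(m+n) + t^(m+n) = (s^m + t^m)(s^n + t^n) - (st)^n (s^(m-n) + t^(m-n)). -/
theorem symSum_add (m n : ℤ × ℤ) (x : K) : t.symSum U (m + n) x =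
    t.symSum U m (t.symSum U n x) - t.bi U n n (t.symSum U (m - n) x) := by
  simp only [symSum, _root_.map_add, bi_bi, add_zero, zero_add, add_sub_cancel]
  abel

theorem symSum_neg (m : ℤ × ℤ) (x : K) :
    t.symSum U (-m) x = t.bi U (-m) (-m) (t.symSum U m x) := by
  simp only [symSum, _root_.map_add, bi_bi, add_zero, neg_add_cancel]
  abel

/-- Every sum `U^m ⊗ 1 + 1 ⊗ U^m` is a polynomial in the operators `U^z ⊗ U^z` and the three such
sums with `m = (1, 0)`, `(0, 1)`, `(1, 1)`. -/
theorem symSum_mem {C : Submodule ℂ K} (hinv : ∀ z, ∀ x ∈ C, t.bi U z z x ∈ C)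
    (h10 : ∀ x ∈ C, t.symSum U (1, 0) x ∈ C) (h01 : ∀ x ∈ C, t.symSum U (0, 1) x ∈ C)
    (h11 : ∀ x ∈ C, t.symSum U (1, 1) x ∈ C) (m : ℤ × ℤ) {x : K} (hx : x ∈ C) :
    t.symSum U m x ∈ C := by
  set G : Set (ℤ × ℤ) := {m | ∀ x ∈ C, t.symSum U m x ∈ C} with hG
  have hzero : (0 : ℤ × ℤ) ∈ G := by
    intro x hx
    rw [symSum, bi_zero]
    exact C.add_mem hx hx
  have hneg : ∀ m ∈ G, -m ∈ G := fun m hm x hx => by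
    rw [symSum_neg]
    exact hinv _ _ (hm x hx)
  have hadd : ∀ m n, m ∈ G → n ∈ G → m - n ∈ G → m + n ∈ G := fun m n hm hn hmn x hx => by
    rw [symSum_add]
    exact C.sub_mem (hm _ (hn x hx)) (hinv _ _ (hmn x hx))
  -- Two consecutive terms of a progression with step in `G` propagate in both directions.
  -- Horizontal progressions give the rows of height 0 and 1, and vertical ones then give
  -- everything; (1, 1) is what starts the row of height 1.
  have hline : ∀ m n, n ∈ G → m ∈ G → m + n ∈ G → ∀ k : ℤ, m + k • n ∈ G := by
    intro m n hn hm hmn k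
    have : m + k • n ∈ G ∧ m + (k + 1) • n ∈ G := by
      induction k using Int.induction_on with
      | zero => simpa using ⟨hm, hmn⟩
      | succ k ih =>
        refine ⟨ih.2, ?_⟩
        have := hadd _ n ih.2 hn (by convert ih.1 using 1; module)
        convert this using 1
        module
      | pred k ih =>
        refine ⟨?_, by convert ih.1 using 1; module⟩
        have := hadd _ (-n) ih.1 (hneg n hn) (by convert ih.2 using 1; module)
        convert this using 1
        module
    exact this.1
  have hrow0 : ∀ k : ℤ, ((k, 0) : ℤ × ℤ) ∈ G := by
    intro k
    have := hline 0 (1, 0) h10 hzero (by simpa using (show ((1, 0) : ℤ × ℤ) ∈ G from h10)) k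
    simpa using this
  have hrow1 : ∀ k : ℤ, ((k, 1) : ℤ × ℤ) ∈ G := by
    intro k
    have := hline (0, 1) (1, 0) h10 h01 (by simpa using (show ((1, 1) : ℤ × ℤ) ∈ G from h11)) k
    simpa using this
  have hall := hline (m.1, 0) (0, 1) h01 (hrow0 _) (by simpa using hrow1 m.1) m.2
  have hm : m ∈ G := by simpa using hall
  exact hm x hx

/-- A closed invariant subspace containing `h ⊗ h` contains all symmetric tensors, if `h` is cyclic
in `H`. -/
theorem add_swap_mem {C : Submodule ℂ K} (hC : IsClosed (C : Set K))
    (hinv : ∀ z, ∀ x ∈ C, t.bi U z z x ∈ C)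
    (hsum : ∀ m, ∀ x ∈ C, t.symSum U m x ∈ C) {H : Submodule ℂ L} {h : L}
    (hH : (Submodule.span ℂ (Set.range fun z => U.toFun z h)).topologicalClosure = H)
    (hh : t.tens h h ∈ C) {x : K} (hx : x ∈ t.prod H H) : x + t.swap x ∈ C := by
  subst hH
  refine t.map_mem_of_forall_tens_of_span (ContinuousLinearMap.id ℂ K +
    t.swap.toLinearIsometry.toContinuousLinearMap) hC ?_ hx
  rintro _ ⟨α, rfl⟩ _ ⟨β, rfl⟩
  change t.tens (U.toFun α h) (U.toFun β h) + t.swap (t.tens (U.toFun α h) (U.toFun β h)) ∈ C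
  -- Applying U^β ⊗ U^β to the symmetric sum for α - β at h ⊗ h gives U^α h ⊗ U^β h + U^β h ⊗ U^α h.
  have := hinv β _ (hsum (α - β) _ hh)
  rw [symSum, _root_.map_add, bi_bi, bi_bi, bi_tens, bi_tens] at this
  rw [swap_tens]
  simpa using this

/-- The relation which a vector of `H ⊗ H` in the range of an intertwining operator defined on `H`
has to satisfy. -/
theorem relation_rearrange {m : ℤ × ℤ} {a b : ℝ} (ha : 0 < a) (hb : 0 < b) {F : K}
    (h : (a : ℂ) • F + (b : ℂ) • t.bi U m m F =
      ((a * a : ℝ) : ℂ) • F + ((a * b : ℝ) : ℂ) • t.symSum U m F +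
        ((b * b : ℝ) : ℂ) • t.bi U m m F) :
    t.bi U 0 m (F - (((1 - b) / a : ℝ) : ℂ) • t.bi U m 0 F) =
      (((1 - a) / b : ℝ) : ℂ) • F - t.bi U m 0 F := by
  have hab : ((a * b : ℝ) : ℂ) ≠ 0 := by exact_mod_cast (mul_pos ha hb).ne'
  rw [map_sub, _root_.map_smul, bi_bi, zero_add, add_zero]
  rw [symSum] at h
  have h1 : ((a * b : ℝ) : ℂ) * (((1 - b) / a : ℝ) : ℂ) = (b - b * b : ℝ) := by
    rw [← Complex.ofReal_mul]; congr 1; field_simp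
  have h2 : ((a * b : ℝ) : ℂ) * (((1 - a) / b : ℝ) : ℂ) = (a - a * a : ℝ) := by
    rw [← Complex.ofReal_mul]; congr 1; field_simp
  apply smul_right_injective K hab
  simp only [smul_sub, smul_smul, h1, h2]
  push_cast at h ⊢
  rw [← sub_eq_zero] at h ⊢
  rw [← neg_eq_zero, ← h]
  module

variable [CompleteSpace L]

/-- There is no nonzero vector in `H ⊗ H` on which the limit operators of the two representations
agree. -/
theorem eq_zero_of_relations {H : Submodule ℂ L} (hHinv : ∀ z, ∀ f ∈ H, U.toFun z f ∈ H)
    {a b a' b' : ℝ} {p p' : ℕ → ℤ × ℤ} (hlim : HasLimitOn U H (1, 0) a b p)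
    (hlim' : HasLimitOn U H (0, 1) a' b' p') {F : K} (hF : F ∈ t.prod H H)
    (h : (a : ℂ) • F + (b : ℂ) • t.bi U (1, 0) (1, 0) F =
      ((a * a : ℝ) : ℂ) • F + ((a * b : ℝ) : ℂ) • t.symSum U (1, 0) F +
        ((b * b : ℝ) : ℂ) • t.bi U (1, 0) (1, 0) F)
    (h' : (a' : ℂ) • F + (b' : ℂ) • t.bi U (0, 1) (0, 1) F =
      ((a' * a' : ℝ) : ℂ) • F + ((a' * b' : ℝ) : ℂ) • t.symSum U (0, 1) F +
        ((b' * b' : ℝ) : ℂ) • t.bi U (0, 1) (0, 1) F) : F = 0 := by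
  by_contra hne
  have key : ∀ (m : ℤ × ℤ) (a b : ℝ) (p : ℕ → ℤ × ℤ), HasLimitOn U H m a b p →
      (a : ℂ) • F + (b : ℂ) • t.bi U m m F =
      ((a * a : ℝ) : ℂ) • F + ((a * b : ℝ) : ℂ) • t.symSum U m F +
        ((b * b : ℝ) : ℂ) • t.bi U m m F →
      ∃ A : ℝ, 1 < A ∧
        t.bi U 0 m (F - (A : ℂ) • t.bi U m 0 F) = (A : ℂ) • F - t.bi U m 0 F := by
    intro m a b p hlim h
    obtain ⟨ha, hb, hab, -⟩ := hlim
    have hr := t.relation_rearrange U ha hb h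
    have hA : 1 < (1 - a) / b := by rw [lt_div_iff₀ hb]; linarith
    have hB : 1 < (1 - b) / a := by rw [lt_div_iff₀ ha]; linarith
    have := coefficient_eq (by linarith) hne _ _ hr
    rw [← this] at hr
    exact ⟨_, hA, hr⟩
  obtain ⟨A, hA, hr⟩ := key _ _ _ _ hlim h
  obtain ⟨A', hA', hr'⟩ := key _ _ _ _ hlim' h'
  obtain ⟨v, hv⟩ := exists_moebius (U.toFun (1, 0)) A hA
  obtain ⟨v', hv'⟩ := exists_moebius (U.toFun (0, 1)) A' hA'
  -- Both v ⊗ 1 and 1 ⊗ U^m send G - A(U^m ⊗ 1)G to AG - (U^m ⊗ 1)G, so v⁻¹ ⊗ U^m fixes the former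
  -- vector.
  have hV : ∀ (m : ℤ × ℤ) (A : ℝ) (v : L ≃ₗᵢ[ℂ] L),
      (∀ x, v (x - (A : ℂ) • U.toFun m x) = (A : ℂ) • x - U.toFun m x) →
      ∀ G : K, t.bi U 0 m (G - (A : ℂ) • t.bi U m 0 G) = (A : ℂ) • G - t.bi U m 0 G →
        t.map v⁻¹ (U.toFun m) (G - (A : ℂ) • t.bi U m 0 G) = G - (A : ℂ) • t.bi U m 0 G := by
    intro m A v hv G hG
    have h1 : t.map v 1 (G - (A : ℂ) • t.bi U m 0 G) = (A : ℂ) • G - t.bi U m 0 G := by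
      refine t.ext_of_tens ((t.map v 1).toLinearIsometry.toContinuousLinearMap.comp
        (ContinuousLinearMap.id ℂ K -
          (A : ℂ) • (t.bi U m 0).toLinearIsometry.toContinuousLinearMap))
        ((A : ℂ) • ContinuousLinearMap.id ℂ K -
          (t.bi U m 0).toLinearIsometry.toContinuousLinearMap) (fun f g => ?_) G
      change t.map v 1 (t.tens f g - (A : ℂ) • t.bi U m 0 (t.tens f g)) =
        (A : ℂ) • t.tens f g - t.bi U m 0 (t.tens f g)
      have e1 : t.tens f g - (A : ℂ) • t.bi U m 0 (t.tens f g) =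
          t.tens (f - (A : ℂ) • U.toFun m f) g := by
        rw [bi_tens, U.map_zero, ← t.tensLeft_apply, ← t.tensLeft_apply, ← t.tensLeft_apply,
          map_sub, _root_.map_smul]
        rfl
      have e2 : (A : ℂ) • t.tens f g - t.bi U m 0 (t.tens f g) =
          t.tens ((A : ℂ) • f - U.toFun m f) g := by
        rw [bi_tens, U.map_zero, ← t.tensLeft_apply, ← t.tensLeft_apply, ← t.tensLeft_apply,
          map_sub, _root_.map_smul]
        rfl
      rw [e1, e2, map_tens, hv]
      rfl
    have h2 : t.map v⁻¹ (U.toFun m) (G - (A : ℂ) • t.bi U m 0 G) =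
        t.map v⁻¹ 1 (t.bi U 0 m (G - (A : ℂ) • t.bi U m 0 G)) := by
      generalize G - (A : ℂ) • t.bi U m 0 G = G'
      rw [bi, map_map, U.map_zero, one_mul, mul_one]
    rw [h2, hG, ← h1, map_map, inv_mul_cancel, one_mul, map_one_one]
  set F₁ : K := F - (A' : ℂ) • t.bi U (0, 1) 0 F with hF₁
  set F₂ : K := F - (A : ℂ) • t.bi U (1, 0) 0 F with hF₂
  -- Applying both commuting factors 1 - A(U^(1,0) ⊗ 1) and 1 - A'(U^(0,1) ⊗ 1) to `F` gives one
  -- vector to which both fixed-point statements apply. Either factor may be taken outermost.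
  set Y : K := F₁ - (A : ℂ) • t.bi U (1, 0) 0 F₁ with hY
  have hY₂ : Y = F₂ - (A' : ℂ) • t.bi U (0, 1) 0 F₂ := by
    simp only [hY, hF₁, hF₂, map_sub, _root_.map_smul, bi_bi, add_comm ((1, 0) : ℤ × ℤ) (0, 1)]
    module
  have hcomm : ∀ (m n : ℤ × ℤ) (A B : ℝ),
      t.bi U 0 m (F - (A : ℂ) • t.bi U m 0 F) = (A : ℂ) • F - t.bi U m 0 F →
      t.bi U 0 m ((F - (B : ℂ) • t.bi U n 0 F) -
        (A : ℂ) • t.bi U m 0 (F - (B : ℂ) • t.bi U n 0 F)) =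
      (A : ℂ) • (F - (B : ℂ) • t.bi U n 0 F) - t.bi U m 0 (F - (B : ℂ) • t.bi U n 0 F) := by
    intro m n A B hr
    have hr2 := congrArg (t.bi U n 0) hr
    simp only [map_sub, _root_.map_smul, bi_bi, add_zero, zero_add] at hr hr2 ⊢
    rw [add_comm n m] at hr2
    have e : t.bi U 0 m F - (B : ℂ) • t.bi U n m F - (A : ℂ) • (t.bi U m m F -
        (B : ℂ) • t.bi U (m + n) m F) = (t.bi U 0 m F - (A : ℂ) • t.bi U m m F) -
        (B : ℂ) • (t.bi U n m F - (A : ℂ) • t.bi U (m + n) m F) := by module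
    rw [e, hr, hr2]
    module
  have hYmem : Y ∈ t.prod ⊤ H := by
    refine t.prod_mono le_top le_rfl (?_ : Y ∈ t.prod H H)
    have hm := fun z (x : K) (hx : x ∈ t.prod H H) => t.bi_mem_prod U hHinv hHinv z 0 hx
    have hm1 : F₁ ∈ t.prod H H :=
      Submodule.sub_mem _ hF (Submodule.smul_mem _ _ (hm _ _ hF))
    exact Submodule.sub_mem _ hm1 (Submodule.smul_mem _ _ (hm _ _ hm1))
  have hY0 : Y = 0 := by
    refine t.eq_zero_of_fixed_generators U hlim v⁻¹ v'⁻¹ hYmem ?_ ?_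
    · exact hV _ A v hv F₁ (hcomm _ _ _ _ hr)
    · rw [hY₂]
      exact hV _ A' v' hv' F₂ (hcomm _ _ _ _ hr')
  -- A kernel vector would satisfy ‖G‖ = A‖G‖ with A > 1, so `Y = 0` gives back `F = 0`.
  have hinj : ∀ (A : ℝ) (m : ℤ × ℤ) (G : K), 1 < A → G - (A : ℂ) • t.bi U m 0 G = 0 → G = 0 := by
    intro A m G hA h0
    have h1 := congrArg norm (sub_eq_zero.1 h0)
    rw [norm_smul, LinearIsometryEquiv.norm_map, Complex.norm_real,
      Real.norm_of_nonneg (by linarith)] at h1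
    have h2 : ‖G‖ = 0 := by nlinarith [norm_nonneg G]
    exact norm_eq_zero.1 h2
  exact hne (hinj _ _ _ hA' (hinj _ _ _ hA hY0))

end TensorSquare

/-! ### Cyclic subspaces of the diagonal action, and disjointness of H ⊗ E from H ⊗ H. -/

/-- Orthogonality makes the sum the fixed-point set of a continuous operator, the sum of the two
projections. -/
theorem isClosed_sup_of_isOrtho {K : Type*} [NormedAddCommGroup K] [InnerProductSpace ℂ K]
    (M N : Submodule ℂ K) [M.HasOrthogonalProjection] [N.HasOrthogonalProjection] (h : M ⟂ N) :
    IsClosed ((M ⊔ N : Submodule ℂ K) : Set K) := by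
  have : ((M ⊔ N : Submodule ℂ K) : Set K) =
      {x | M.starProjection x + N.starProjection x = x} := by
    ext x
    constructor
    · intro hx
      obtain ⟨y, hy, z, hz, rfl⟩ := Submodule.mem_sup.1 hx
      change M.starProjection (y + z) + N.starProjection (y + z) = y + z
      rw [map_add, map_add, Submodule.starProjection_eq_self_iff.2 hy,
        Submodule.starProjection_eq_self_iff.2 hz,
        (Submodule.starProjection_apply_eq_zero_iff _).2 (h.symm hz),
        (Submodule.starProjection_apply_eq_zero_iff _).2 (h hy)]
      simp
    · intro hx
      have hx' : M.starProjection x + N.starProjection x = x := hx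
      rw [← hx']
      exact Submodule.add_mem_sup (Submodule.starProjection_apply_mem _ _)
        (Submodule.starProjection_apply_mem _ _)
  rw [this]
  exact isClosed_eq (by fun_prop) continuous_id

theorem eq_zero_of_add_eq_zero_of_isOrtho {K : Type*} [NormedAddCommGroup K]
    [InnerProductSpace ℂ K] {M N : Submodule ℂ K} (h : M ⟂ N) {x y : K} (hx : x ∈ M)
    (hy : y ∈ N) (hxy : x + y = 0) : x = 0 ∧ y = 0 := by
  have h0 : inner ℂ x (x + y) = 0 := by rw [hxy, inner_zero_right]
  rw [inner_add_right, Submodule.isOrtho_iff_inner_eq.1 h x hx y hy, add_zero,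
    inner_self_eq_zero] at h0
  exact ⟨h0, by simpa [h0] using hxy⟩

theorem UnitaryRep.mem_orthogonal {L : Type*} [NormedAddCommGroup L] [InnerProductSpace ℂ L]
    (U : UnitaryRep L) {E : Submodule ℂ L} (hE : ∀ z, ∀ f ∈ E, U.toFun z f = f) (z : ℤ × ℤ)
    {f : L} (hf : f ∈ Eᗮ) : U.toFun z f ∈ Eᗮ := by
  rw [Submodule.mem_orthogonal] at hf ⊢
  intro g hg
  rw [← hE z g hg, LinearIsometryEquiv.inner_map_map]
  exact hf g hg

namespace TensorSquare

variable {L K : Type*} [NormedAddCommGroup L] [InnerProductSpace ℂ L]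
  [NormedAddCommGroup K] [InnerProductSpace ℂ K] [CompleteSpace K]
  (t : TensorSquare L K) (U : UnitaryRep L)

/-- The cyclic subspace of the diagonal action generated by `x`. -/
def cyclic (x : K) : Submodule ℂ K :=
  (Submodule.span ℂ (Set.range fun z => t.bi U z z x)).topologicalClosure

theorem isClosed_cyclic (x : K) : IsClosed (t.cyclic U x : Set K) :=
  Submodule.isClosed_topologicalClosure _

theorem self_mem_cyclic (x : K) : x ∈ t.cyclic U x := by
  have : t.bi U 0 0 x ∈ t.cyclic U x := subset_closure_span _ ⟨0, rfl⟩
  rwa [bi_zero] at this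

theorem bi_mem_cyclic (x : K) (z : ℤ × ℤ) {y : K} (hy : y ∈ t.cyclic U x) :
    t.bi U z z y ∈ t.cyclic U x := by
  refine mem_closure_span_of_map (t.bi U z z).toLinearIsometry.toContinuousLinearMap _ _
    (t.isClosed_cyclic U x) ?_ hy
  rintro _ ⟨w, rfl⟩
  change t.bi U z z (t.bi U w w x) ∈ _
  rw [bi_bi]
  exact subset_closure_span _ ⟨z + w, rfl⟩

theorem cyclic_le {x : K} {C : Submodule ℂ K} (hC : IsClosed (C : Set K))
    (hinv : ∀ z, ∀ y ∈ C, t.bi U z z y ∈ C) (hx : x ∈ C) : t.cyclic U x ≤ C := by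
  refine closure_span_le _ _ hC ?_
  rintro _ ⟨z, rfl⟩
  exact hinv z x hx

theorem starProjection_bi (C : Submodule ℂ K) [C.HasOrthogonalProjection]
    (hinv : ∀ z, ∀ y ∈ C, t.bi U z z y ∈ C) (z : ℤ × ℤ) (x : K) :
    C.starProjection (t.bi U z z x) = t.bi U z z (C.starProjection x) := by
  refine starProjection_comm C _ (hinv z) (fun y hy => ?_) x
  rw [bi_symm]
  exact hinv _ y hy

/-- Symmetric tensors are generated by `h ⊗ h` if `h` is cyclic in `H`. -/
theorem mem_cyclic_of_symmetric {H : Submodule ℂ L} {h : L}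
    (hHinv : ∀ z, ∀ f ∈ H, U.toFun z f ∈ H)
    (hH : (Submodule.span ℂ (Set.range fun z => U.toFun z h)).topologicalClosure = H)
    {a b : Fin 3 → ℝ} {p : Fin 3 → ℕ → ℤ × ℤ}
    (hlim : ∀ j, HasLimitOn U H ((![(1, 0), (0, 1), (1, 1)] : Fin 3 → ℤ × ℤ) j) (a j) (b j) (p j))
    {x : K} (hx : x ∈ t.prod H H) (hsym : t.swap x = x) :
    x ∈ t.cyclic U (t.tens h h) := by
  have hhH : h ∈ H := by
    have : U.toFun 0 h ∈ H := hH ▸ subset_closure_span _ ⟨0, rfl⟩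
    rwa [U.map_zero] at this
  have hle : t.cyclic U (t.tens h h) ≤ t.prod H H :=
    t.cyclic_le U (t.isClosed_prod _ _) (fun z y hy => t.bi_mem_prod U hHinv hHinv z z hy)
      (t.tens_mem_prod hhH hhH)
  have hinv := fun (z : ℤ × ℤ) (y : K) (hy : y ∈ t.cyclic U (t.tens h h)) =>
    t.bi_mem_cyclic U (t.tens h h) z hy
  have hj := fun j (y : K) (hy : y ∈ t.cyclic U (t.tens h h)) =>
    t.symSum_mem_of_hasLimitOn U hinv (t.isClosed_cyclic U _) hle (hlim j) hy
  have h2 := t.add_swap_mem U (t.isClosed_cyclic U _) hinv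
    (fun m y hy => t.symSum_mem U hinv (hj 0) (hj 1) (hj 2) m hy) hH (t.self_mem_cyclic U _) hx
  rw [hsym, ← two_smul ℂ x] at h2
  exact (Submodule.smul_mem_iff _ two_ne_zero).1 h2

/-- The spectral types of `H ⊗ E` and of `H ⊗ H` are disjoint. -/
theorem tens_mem_cyclic_add [CompleteSpace L] {E : Submodule ℂ L} [E.HasOrthogonalProjection]
    (hE : ∀ z, ∀ f ∈ E, U.toFun z f = f) {h e : L} (hh : h ∈ Eᗮ) (he : e ∈ E)
    {a b a' b' : ℝ} {p p' : ℕ → ℤ × ℤ} (hlim : HasLimitOn U Eᗮ (1, 0) a b p)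
    (hlim' : HasLimitOn U Eᗮ (0, 1) a' b' p') :
    t.tens h e ∈ t.cyclic U (t.tens h e + t.tens h h) := by
  set v := t.tens h e + t.tens h h with hv
  set C := t.cyclic U v with hC
  have : CompleteSpace C := (t.isClosed_cyclic U v).completeSpace_coe
  have hEinv : ∀ z, ∀ f ∈ E, U.toFun z f ∈ E := fun z f hf => by rwa [hE z f hf]
  have hHinv : ∀ z, ∀ f ∈ Eᗮ, U.toFun z f ∈ Eᗮ := fun z f hf => U.mem_orthogonal hE z hf
  have hEH : E ⟂ Eᗮ := Submodule.isOrtho_orthogonal_right E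
  have hQ := t.starProjection_bi U C (fun z y hy => t.bi_mem_cyclic U v z hy)
  have hPr := t.starProjection_bi U (t.prod Eᗮ Eᗮ)
    (fun z y hy => t.bi_mem_prod U hHinv hHinv z z hy)
  have hx : t.tens h e ∈ t.prod Eᗮ E := t.tens_mem_prod hh he
  set x := t.tens h e with hxdef
  set F := (t.prod Eᗮ Eᗮ).starProjection (C.starProjection x) with hF
  have hFmem : F ∈ t.prod Eᗮ Eᗮ := Submodule.starProjection_apply_mem _ _
  -- The projection to `C` followed by that to H ⊗ H commutes with the diagonal action and sends `x`
  -- to `F`. It transports the weak limit on H ⊗ E, which must agree with the limit at `F` computed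
  -- in H ⊗ H.
  have hrel : ∀ (m : ℤ × ℤ) (a b : ℝ) (p : ℕ → ℤ × ℤ), HasLimitOn U Eᗮ m a b p →
      (a : ℂ) • F + (b : ℂ) • t.bi U m m F =
      ((a * a : ℝ) : ℂ) • F + ((a * b : ℝ) : ℂ) • t.symSum U m F +
        ((b * b : ℝ) : ℂ) • t.bi U m m F := by
    intro m a b p hlim
    refine ext_inner_left ℂ fun y => ?_
    refine tendsto_nhds_unique ?_ (t.tendsto_inner_bi_prod U hlim hFmem y)
    have h1 := t.tendsto_inner_bi_prod_invariant U hlim hE hx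
      (C.starProjection ((t.prod Eᗮ Eᗮ).starProjection y))
    have hadj : ∀ u : K, inner ℂ (C.starProjection ((t.prod Eᗮ Eᗮ).starProjection y)) u =
        inner ℂ y ((t.prod Eᗮ Eᗮ).starProjection (C.starProjection u)) := by
      intro u
      rw [Submodule.inner_starProjection_left_eq_right,
        Submodule.inner_starProjection_left_eq_right]
    simp only [hadj, hQ, hPr, _root_.map_add, _root_.map_smul] at h1
    exact h1
  have hF0 : F = 0 := t.eq_zero_of_relations U hHinv hlim hlim' hFmem (hrel _ _ _ _ hlim)
    (hrel _ _ _ _ hlim')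
  have hCle : ∀ M N : Submodule ℂ L, (∀ z, ∀ f ∈ M, U.toFun z f ∈ M) →
      (∀ z, ∀ f ∈ N, U.toFun z f ∈ N) → v ∈ (t.prod M N)ᗮ → C ≤ (t.prod M N)ᗮ := by
    intro M N hM hN hvm
    refine t.cyclic_le U (Submodule.isClosed_orthogonal _) (fun z y hy => ?_) hvm
    rw [Submodule.mem_orthogonal] at hy ⊢
    intro u hu
    have := hy _ (t.bi_mem_prod U hM hN (-z) (-z) hu)
    rw [← bi_symm] at this
    rwa [← (t.bi U z z).symm.inner_map_map, (t.bi U z z).symm_apply_apply]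
  set q := C.starProjection x with hq
  have hqC : q ∈ C := Submodule.starProjection_apply_mem _ _
  have hvE : ∀ N : Submodule ℂ L, v ∈ (t.prod E N)ᗮ := fun N =>
    Submodule.add_mem _ ((t.prod_isOrtho (Or.inl hEH.symm)) hx)
      ((t.prod_isOrtho (Or.inl hEH.symm)) (t.tens_mem_prod hh hh))
  have hqEE := hCle E E hEinv hEinv (hvE E) hqC
  have hqEH := hCle E Eᗮ hEinv hHinv (hvE _) hqC
  have hqHH : q ∈ (t.prod Eᗮ Eᗮ)ᗮ := (Submodule.starProjection_apply_eq_zero_iff _).1 hF0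
  -- The projection `q` of `x` to `C` has no component in the other three blocks: `F = 0` removes H
  -- ⊗ H, and `C` is orthogonal to the two blocks starting with `E`.
  have hqmem : q ∈ t.prod Eᗮ E := by
    have hp : (t.prod Eᗮ E).starProjection q ∈ t.prod Eᗮ E :=
      Submodule.starProjection_apply_mem _ _
    have h0 : q - (t.prod Eᗮ E).starProjection q = 0 := by
      refine t.eq_zero_of_orthogonal_prods E ?_ ?_ ?_ ?_
      · exact Submodule.sub_mem _ hqEE ((t.prod_isOrtho (Or.inl hEH.symm)) hp)
      · exact Submodule.sub_starProjection_mem_orthogonal _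
      · exact Submodule.sub_mem _ hqEH ((t.prod_isOrtho (Or.inl hEH.symm)) hp)
      · exact Submodule.sub_mem _ hqHH ((t.prod_isOrtho (Or.inr hEH)) hp)
    rw [sub_eq_zero.1 h0]
    exact hp
  have hyC : x - q ∈ Cᗮ := Submodule.sub_starProjection_mem_orthogonal _
  have hy1 : inner ℂ v (x - q) = 0 :=
    Submodule.inner_right_of_mem_orthogonal (t.self_mem_cyclic U v) hyC
  have hy2 : inner ℂ q (x - q) = 0 := Submodule.inner_right_of_mem_orthogonal hqC hyC
  have hy3 : inner ℂ (t.tens h h) (x - q) = 0 :=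
    Submodule.isOrtho_iff_inner_eq.1 (t.prod_isOrtho (Or.inr hEH.symm)) _
      (t.tens_mem_prod hh hh) _ (Submodule.sub_mem _ hx hqmem)
  -- `x - q` is orthogonal to `v` and to h ⊗ h, hence to `x`, their difference; it is also
  -- orthogonal to `q`.
  have hy4 : inner ℂ (x - q) (x - q) = 0 := by
    rw [hv, inner_add_left, hy3, add_zero] at hy1
    rw [inner_sub_left, hy1, hy2, sub_zero]
  rw [inner_self_eq_zero, sub_eq_zero] at hy4
  rw [hy4]
  exact hqC

end TensorSquare

/-! ### Comparison of symmetric and antisymmetric tensors. -/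

namespace TensorSquare

variable {L K : Type*} [NormedAddCommGroup L] [InnerProductSpace ℂ L]
  [NormedAddCommGroup K] [InnerProductSpace ℂ K] [CompleteSpace K]
  (t : TensorSquare L K) (U : UnitaryRep L)

/-- The operator `U^m ⊗ 1 - 1 ⊗ U^m`. -/
def antiSum (m : ℤ × ℤ) : K →L[ℂ] K :=
  (t.bi U m 0).toLinearIsometry.toContinuousLinearMap -
    (t.bi U 0 m).toLinearIsometry.toContinuousLinearMap

theorem antiSum_apply (m : ℤ × ℤ) (x : K) : t.antiSum U m x = t.bi U m 0 x - t.bi U 0 m x := rfl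

theorem antiSum_bi (m z : ℤ × ℤ) (x : K) :
    t.antiSum U m (t.bi U z z x) = t.bi U z z (t.antiSum U m x) := by
  simp only [antiSum_apply, map_sub, bi_bi, add_comm]

theorem antiSum_antiSum (m n : ℤ × ℤ) (x : K) :
    t.antiSum U m (t.antiSum U n x) = t.antiSum U n (t.antiSum U m x) := by
  simp only [antiSum_apply, map_sub, bi_bi, add_zero, zero_add, add_comm m n]
  abel

theorem swap_antiSum (m : ℤ × ℤ) (x : K) :
    t.swap (t.antiSum U m x) = -t.antiSum U m (t.swap x) := by
  simp only [antiSum_apply, map_sub, swap_bi, neg_sub]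

/-- The adjoint is, up to sign and a unitary of the action, the operator itself. Hence its kernel is
orthogonal to its range, and injectivity and density of range reduce to the same question. -/
theorem inner_antiSum (m : ℤ × ℤ) (x y : K) :
    inner ℂ (t.antiSum U m x) y = -inner ℂ x (t.bi U (-m) (-m) (t.antiSum U m y)) := by
  have h1 : ∀ z w : ℤ × ℤ, inner ℂ (t.bi U z w x) y = inner ℂ x (t.bi U (-z) (-w) y) := by
    intro z w
    rw [← bi_symm, ← (t.bi U z w).symm.inner_map_map, (t.bi U z w).symm_apply_apply]
  simp only [antiSum_apply, map_sub, bi_bi, inner_sub_left, inner_sub_right, h1, neg_add_cancel,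
    add_zero, neg_zero, neg_sub]

theorem antiSum_mem_prod {H : Submodule ℂ L} (hHinv : ∀ z, ∀ f ∈ H, U.toFun z f ∈ H)
    (m : ℤ × ℤ) {x : K} (hx : x ∈ t.prod H H) : t.antiSum U m x ∈ t.prod H H :=
  Submodule.sub_mem _ (t.bi_mem_prod U hHinv hHinv _ _ hx) (t.bi_mem_prod U hHinv hHinv _ _ hx)

theorem antiSum_eq_zero_of_inner {M : Submodule ℂ K} (m : ℤ × ℤ) {y : K}
    (hy : t.bi U (-m) (-m) (t.antiSum U m y) ∈ M)
    (h : ∀ x ∈ M, inner ℂ (t.antiSum U m x) y = 0) : t.antiSum U m y = 0 := by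
  have h0 := h _ hy
  rw [inner_antiSum, neg_eq_zero, inner_self_eq_zero] at h0
  simpa using h0

/-- A vector killed by U^n ⊗ 1 - 1 ⊗ U^n is fixed by U^(-n) ⊗ U^n; taking both generators leaves
only zero. -/
theorem eq_zero_of_antiSum_eq_zero {H : Submodule ℂ L} {m : ℤ × ℤ} {a b : ℝ}
    {p : ℕ → ℤ × ℤ} (hlim : HasLimitOn U H m a b p) {x : K} (hx : x ∈ t.prod H H)
    (h1 : t.antiSum U (1, 0) x = 0) (h2 : t.antiSum U (0, 1) x = 0) : x = 0 := by
  have key : ∀ n, t.antiSum U n x = 0 → t.bi U (-n) n x = x := by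
    intro n hn
    rw [antiSum_apply, sub_eq_zero] at hn
    have := congrArg (t.bi U (-n) 0) hn
    rw [bi_bi, bi_bi, neg_add_cancel, add_zero, add_zero, zero_add, bi_zero] at this
    exact this.symm
  exact t.eq_zero_of_fixed_generators U hlim (U.toFun (-(1, 0))) (U.toFun (-(0, 1)))
    (t.prod_mono le_top le_rfl hx) (key _ h1) (key _ h2)

/-- The antisymmetric operator on `H ⊗ H` used to compare symmetric and antisymmetric tensors is
`U^m ⊗ 1 - 1 ⊗ U^m` with `m = (1, 0)` off the kernel of the latter, and the same with `m = (0, 1)`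
on this kernel. -/
theorem exists_antisymmetric_intertwiner {H : Submodule ℂ L}
    (hHinv : ∀ z, ∀ f ∈ H, U.toFun z f ∈ H) {m : ℤ × ℤ} {a b : ℝ}
    {p : ℕ → ℤ × ℤ} (hlim : HasLimitOn U H m a b p) :
    ∃ D : K →L[ℂ] K, (∀ z x, D (t.bi U z z x) = t.bi U z z (D x)) ∧
      (∀ x, t.swap (D x) = -D (t.swap x)) ∧
      (∀ x ∈ t.prod H H, D x ∈ t.prod H H) ∧
      (∀ x ∈ t.prod H H, D x = 0 → x = 0) ∧
      ∀ y ∈ t.prod H H, (∀ x ∈ t.prod H H, inner ℂ (D x) y = 0) → y = 0 := by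
  set d₁ := t.antiSum U (1, 0) with hd₁
  set d₂ := t.antiSum U (0, 1) with hd₂
  set M : Submodule ℂ K := LinearMap.ker d₁.toLinearMap ⊓ t.prod H H with hM
  have hMmem : ∀ x, x ∈ M ↔ d₁ x = 0 ∧ x ∈ t.prod H H := fun x => Iff.rfl
  have hMc : IsClosed (M : Set K) := d₁.isClosed_ker.inter (t.isClosed_prod H H)
  have : CompleteSpace M := hMc.completeSpace_coe
  have hMle : M ≤ t.prod H H := inf_le_right
  have hMbi : ∀ z, ∀ x ∈ M, t.bi U z z x ∈ M := by
    intro z x hx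
    rw [hMmem] at hx ⊢
    exact ⟨by rw [antiSum_bi, hx.1, _root_.map_zero], t.bi_mem_prod U hHinv hHinv z z hx.2⟩
  have hMswap : ∀ x ∈ M, t.swap x ∈ M := by
    intro x hx
    rw [hMmem] at hx ⊢
    refine ⟨?_, t.swap_mem_prod hx.2⟩
    have := t.swap_antiSum U (1, 0) x
    rw [← hd₁, hx.1, _root_.map_zero, eq_comm, neg_eq_zero] at this
    exact this
  have hMd₂ : ∀ x ∈ M, d₂ x ∈ M := by
    intro x hx
    rw [hMmem] at hx ⊢
    exact ⟨by rw [antiSum_antiSum, ← hd₁, hx.1, _root_.map_zero],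
      t.antiSum_mem_prod U hHinv _ hx.2⟩
  set P := M.starProjection with hP
  have hPmem : ∀ x, P x ∈ M := fun x => Submodule.starProjection_apply_mem _ _
  have hPself : ∀ x ∈ M, P x = x := fun x hx => Submodule.starProjection_eq_self_iff.2 hx
  have hPbi := t.starProjection_bi U M hMbi
  have hPswap : ∀ x, P (t.swap x) = t.swap (P x) :=
    starProjection_comm M t.swap hMswap (fun x hx => by
      have : t.swap.symm x = t.swap x := by
        rw [LinearIsometryEquiv.symm_apply_eq, swap_swap]
      rw [this]
      exact hMswap x hx)
  have hd₁M : ∀ x, ∀ y ∈ M, inner ℂ (d₁ x) y = 0 := by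
    intro x y hy
    rw [inner_antiSum, ← hd₁, ((hMmem y).1 hy).1]
    simp
  refine ⟨d₁ + d₂.comp P, ?_, ?_, ?_, ?_, ?_⟩
  · intro z x
    change d₁ (t.bi U z z x) + d₂ (P (t.bi U z z x)) = t.bi U z z (d₁ x + d₂ (P x))
    rw [hPbi, hd₁, hd₂, antiSum_bi, antiSum_bi, _root_.map_add]
  · intro x
    change t.swap (d₁ x + d₂ (P x)) = -(d₁ (t.swap x) + d₂ (P (t.swap x)))
    rw [hPswap, _root_.map_add, hd₁, hd₂, swap_antiSum, swap_antiSum, neg_add]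
  · intro x hx
    exact Submodule.add_mem _ (t.antiSum_mem_prod U hHinv _ hx)
      (t.antiSum_mem_prod U hHinv _ (hMle (hPmem x)))
  · intro x hx h0
    have h0' : d₁ x + d₂ (P x) = 0 := h0
    -- The range of `d₁` is orthogonal to `M`, while `d₂ (P x)` lies in `M`. The two summands
    -- therefore vanish separately, which puts `x` in `M` and makes both operators kill it.
    have horth : inner ℂ (d₁ x + d₂ (P x)) (d₂ (P x)) = 0 := by rw [h0', inner_zero_left]
    rw [inner_add_left, hd₁M x _ (hMd₂ _ (hPmem x)), zero_add, inner_self_eq_zero] at horth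
    have h1 : d₁ x = 0 := by simpa [horth] using h0'
    rw [hPself x ((hMmem x).2 ⟨h1, hx⟩)] at horth
    exact t.eq_zero_of_antiSum_eq_zero U hlim hx h1 horth
  · intro y hy h
    have h' : ∀ x ∈ t.prod H H, inner ℂ (d₁ x + d₂ (P x)) y = 0 := h
    have hd₂y : ∀ x ∈ M, inner ℂ (d₂ x) y = 0 := by
      intro x hx
      have := h' x (hMle hx)
      rwa [hPself x hx, ((hMmem x).1 hx).1, zero_add] at this
    have hd₁y : ∀ x ∈ t.prod H H, inner ℂ (d₁ x) y = 0 := by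
      intro x hx
      have := h' x hx
      rwa [inner_add_left, hd₂y _ (hPmem x), add_zero] at this
    have h1 : d₁ y = 0 := t.antiSum_eq_zero_of_inner U (1, 0)
      (t.bi_mem_prod U hHinv hHinv _ _ (t.antiSum_mem_prod U hHinv _ hy)) hd₁y
    have hyM : y ∈ M := (hMmem y).2 ⟨h1, hy⟩
    have h2 : d₂ y = 0 := t.antiSum_eq_zero_of_inner U (0, 1) (hMbi _ _ (hMd₂ y hyM)) hd₂y
    exact t.eq_zero_of_antiSum_eq_zero U hlim hy h1 h2

/-- The tensors in `H ⊗ H` which the flip multiplies by `c`. -/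
def flipEigenspace (H : Submodule ℂ L) (c : ℂ) : Submodule ℂ K :=
  t.prod H H ⊓ LinearMap.ker (t.swap.toLinearIsometry.toContinuousLinearMap -
    c • ContinuousLinearMap.id ℂ K).toLinearMap

theorem mem_flipEigenspace {H : Submodule ℂ L} {c : ℂ} {x : K} :
    x ∈ t.flipEigenspace H c ↔ x ∈ t.prod H H ∧ t.swap x = c • x := by
  refine and_congr Iff.rfl ?_
  change t.swap x - c • x = 0 ↔ _
  rw [sub_eq_zero]

theorem isClosed_flipEigenspace (H : Submodule ℂ L) (c : ℂ) :
    IsClosed (t.flipEigenspace H c : Set K) :=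
  (t.isClosed_prod H H).inter (ContinuousLinearMap.isClosed_ker _)

instance (H : Submodule ℂ L) (c : ℂ) : CompleteSpace (t.flipEigenspace H c) :=
  (t.isClosed_flipEigenspace H c).completeSpace_coe

theorem flipEigenspace_le (H : Submodule ℂ L) (c : ℂ) : t.flipEigenspace H c ≤ t.prod H H :=
  inf_le_left

theorem bi_mem_flipEigenspace {H : Submodule ℂ L} (hHinv : ∀ z, ∀ f ∈ H, U.toFun z f ∈ H) {c : ℂ}
    (z : ℤ × ℤ) {x : K} (hx : x ∈ t.flipEigenspace H c) :
    t.bi U z z x ∈ t.flipEigenspace H c := by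
  rw [mem_flipEigenspace] at hx ⊢
  exact ⟨t.bi_mem_prod U hHinv hHinv z z hx.1, by rw [swap_bi, hx.2, _root_.map_smul]⟩

theorem flipEigenspace_isOrtho (H : Submodule ℂ L) :
    t.flipEigenspace H 1 ⟂ t.flipEigenspace H (-1) := by
  rw [Submodule.isOrtho_iff_inner_eq]
  intro x hx y hy
  rw [mem_flipEigenspace] at hx hy
  have h := t.swap.inner_map_map x y
  rw [hx.2, hy.2, one_smul, neg_one_smul, inner_neg_right] at h
  have h2 : (2 : ℂ) * inner ℂ x y = 0 := by linear_combination -h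
  simpa using h2

theorem exists_flip_decomposition {H : Submodule ℂ L} {x : K} (hx : x ∈ t.prod H H) :
    ∃ y ∈ t.flipEigenspace H 1, ∃ z ∈ t.flipEigenspace H (-1), y + z = x := by
  have hs := t.swap_mem_prod hx
  refine ⟨(2⁻¹ : ℂ) • (x + t.swap x), ?_, (2⁻¹ : ℂ) • (x - t.swap x), ?_, ?_⟩
  · rw [mem_flipEigenspace]
    refine ⟨Submodule.smul_mem _ _ (Submodule.add_mem _ hx hs), ?_⟩
    rw [_root_.map_smul, _root_.map_add, swap_swap]
    module
  · rw [mem_flipEigenspace]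
    refine ⟨Submodule.smul_mem _ _ (Submodule.sub_mem _ hx hs), ?_⟩
    rw [_root_.map_smul, map_sub, swap_swap]
    module
  · module

/-! ### Assembly of the two cyclic summands. -/

/-- The orthogonal complement of `E ⊗ E` in the tensor square is the orthogonal sum of two
isomorphic cyclic subspaces. -/
theorem exists_cyclic_decomposition [CompleteSpace L] {E : Submodule ℂ L}
    [E.HasOrthogonalProjection] (hE : ∀ z, ∀ f ∈ E, U.toFun z f = f) {h e : L} (he : E = ℂ ∙ e)
    (hcyc : (Submodule.span ℂ (Set.range fun z => U.toFun z h)).topologicalClosure = Eᗮ)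
    {a b : Fin 3 → ℝ} {p : Fin 3 → ℕ → ℤ × ℤ}
    (hlim : ∀ j, HasLimitOn U Eᗮ ((![(1, 0), (0, 1), (1, 1)] : Fin 3 → ℤ × ℤ) j)
      (a j) (b j) (p j)) :
    ∃ C D : Submodule ℂ K, C ⟂ D ∧ C ⊔ D = (t.prod E E)ᗮ ∧
      IsCyclicSubspace (fun z => (t.bi U z z).toLinearIsometry) C ∧
      IsCyclicSubspace (fun z => (t.bi U z z).toLinearIsometry) D ∧
      (∀ z, ∀ x ∈ C, t.bi U z z x ∈ C) ∧
      (∀ z, ∀ x ∈ D, t.bi U z z x ∈ D) ∧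
      RestrictionsIsomorphic (fun z => (t.bi U z z).toLinearIsometry) C D := by
  have hEinv : ∀ z, ∀ f ∈ E, U.toFun z f ∈ E := fun z f hf => by rwa [hE z f hf]
  have hHinv : ∀ z, ∀ f ∈ Eᗮ, U.toFun z f ∈ Eᗮ := fun z f hf => U.mem_orthogonal hE z hf
  have hEH : E ⟂ Eᗮ := Submodule.isOrtho_orthogonal_right E
  have heE : e ∈ E := by rw [he]; exact Submodule.mem_span_singleton_self e
  have hhH : h ∈ Eᗮ := by
    have : U.toFun 0 h ∈ Eᗮ := hcyc ▸ subset_closure_span _ ⟨0, rfl⟩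
    rwa [U.map_zero] at this
  set H₁ := t.prod Eᗮ E with hH₁
  set H₂ := t.prod E Eᗮ with hH₂
  set HH := t.prod Eᗮ Eᗮ with hHH
  set S := t.flipEigenspace Eᗮ 1 with hS
  set Q := t.flipEigenspace Eᗮ (-1) with hQ
  have hSle : S ≤ HH := t.flipEigenspace_le _ _
  have hQle : Q ≤ HH := t.flipEigenspace_le _ _
  have o12 : H₁ ⟂ H₂ := t.prod_isOrtho (Or.inl hEH.symm)
  have o1H : H₁ ⟂ HH := t.prod_isOrtho (Or.inr hEH)
  have o2H : H₂ ⟂ HH := t.prod_isOrtho (Or.inl hEH)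
  have oSQ : S ⟂ Q := t.flipEigenspace_isOrtho _
  have hCc : IsClosed ((H₁ ⊔ S : Submodule ℂ K) : Set K) :=
    isClosed_sup_of_isOrtho _ _ (o1H.mono_right hSle)
  have hDc : IsClosed ((H₂ ⊔ Q : Submodule ℂ K) : Set K) :=
    isClosed_sup_of_isOrtho _ _ (o2H.mono_right hQle)
  have hCinv : ∀ z, ∀ x ∈ H₁ ⊔ S, t.bi U z z x ∈ H₁ ⊔ S := by
    intro z x hx
    obtain ⟨y, hy, w, hw, rfl⟩ := Submodule.mem_sup.1 hx
    rw [_root_.map_add]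
    exact Submodule.add_mem_sup (t.bi_mem_prod U hHinv hEinv z z hy)
      (t.bi_mem_flipEigenspace U hHinv z hw)
  have hDinv : ∀ z, ∀ x ∈ H₂ ⊔ Q, t.bi U z z x ∈ H₂ ⊔ Q := by
    intro z x hx
    obtain ⟨y, hy, w, hw, rfl⟩ := Submodule.mem_sup.1 hx
    rw [_root_.map_add]
    exact Submodule.add_mem_sup (t.bi_mem_prod U hEinv hHinv z z hy)
      (t.bi_mem_flipEigenspace U hHinv z hw)
  have hortho : H₁ ⊔ S ⟂ H₂ ⊔ Q := by
    rw [Submodule.isOrtho_sup_left, Submodule.isOrtho_sup_right, Submodule.isOrtho_sup_right]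
    exact ⟨⟨o12, o1H.mono_right hQle⟩, (o2H.mono_right hSle).symm, oSQ⟩
  have hsup : (H₁ ⊔ S) ⊔ (H₂ ⊔ Q) = (t.prod E E)ᗮ := by
    refine le_antisymm ?_ fun x hx => ?_
    · have a1 : H₁ ≤ (t.prod E E)ᗮ := t.prod_isOrtho (Or.inl hEH.symm)
      have a2 : H₂ ≤ (t.prod E E)ᗮ := t.prod_isOrtho (Or.inr hEH.symm)
      have a3 : HH ≤ (t.prod E E)ᗮ := t.prod_isOrtho (Or.inl hEH.symm)
      exact sup_le (sup_le a1 (hSle.trans a3)) (sup_le a2 (hQle.trans a3))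
    · set x₁ := H₁.starProjection x with hx₁
      set x₂ := H₂.starProjection x with hx₂
      set x₃ := HH.starProjection x with hx₃
      have m1 : x₁ ∈ H₁ := Submodule.starProjection_apply_mem _ _
      have m2 : x₂ ∈ H₂ := Submodule.starProjection_apply_mem _ _
      have m3 : x₃ ∈ HH := Submodule.starProjection_apply_mem _ _
      have h0 : x - x₁ - x₂ - x₃ = 0 := by
        refine t.eq_zero_of_orthogonal_prods E ?_ ?_ ?_ ?_
        · exact Submodule.sub_mem _ (Submodule.sub_mem _ (Submodule.sub_mem _ hx
            ((t.prod_isOrtho (Or.inl hEH.symm)) m1)) ((t.prod_isOrtho (Or.inr hEH.symm)) m2))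
            ((t.prod_isOrtho (Or.inl hEH.symm)) m3)
        · exact Submodule.sub_mem _ (Submodule.sub_mem _
            (Submodule.sub_starProjection_mem_orthogonal _) (o12.symm m2)) (o1H.symm m3)
        · rw [sub_right_comm x]
          exact Submodule.sub_mem _ (Submodule.sub_mem _
            (Submodule.sub_starProjection_mem_orthogonal _) (o12 m1)) (o2H.symm m3)
        · rw [sub_right_comm, sub_right_comm x]
          exact Submodule.sub_mem _ (Submodule.sub_mem _
            (Submodule.sub_starProjection_mem_orthogonal _) (o1H m1)) (o2H m2)
      obtain ⟨y, hy, w, hw, hyw⟩ := t.exists_flip_decomposition m3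
      have hxe : x = (x₁ + y) + (x₂ + w) := by
        rw [sub_sub, sub_sub, sub_eq_zero] at h0
        conv_lhs => rw [h0, ← hyw]
        abel
      rw [hxe]
      exact Submodule.add_mem_sup (Submodule.add_mem_sup m1 hy) (Submodule.add_mem_sup m2 hw)
  have hcycC : IsCyclicSubspace (fun z => (t.bi U z z).toLinearIsometry) (H₁ ⊔ S) := by
    refine ⟨t.tens h e + t.tens h h, ?_⟩
    change t.cyclic U (t.tens h e + t.tens h h) = _
    set C := t.cyclic U (t.tens h e + t.tens h h) with hC
    have hhS : t.tens h h ∈ S := by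
      rw [mem_flipEigenspace]
      exact ⟨t.tens_mem_prod hhH hhH, by rw [swap_tens, one_smul]⟩
    have hheC : t.tens h e ∈ C := t.tens_mem_cyclic_add U hE hhH heE (hlim 0) (hlim 1)
    have hhhC : t.tens h h ∈ C := by
      have := C.sub_mem (t.self_mem_cyclic U (t.tens h e + t.tens h h)) hheC
      rwa [add_sub_cancel_left] at this
    have hinv := fun z (y : K) (hy : y ∈ C) => t.bi_mem_cyclic U _ z hy
    refine le_antisymm (t.cyclic_le U hCc hCinv
      (Submodule.add_mem_sup (t.tens_mem_prod hhH heE) hhS)) (sup_le ?_ ?_)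
    · have hE' : E ≤ (Submodule.span ℂ ({e} : Set L)).topologicalClosure := by
        rw [he]; exact Submodule.le_topologicalClosure _
      intro x hx
      refine t.map_mem_of_forall_tens_of_span (ContinuousLinearMap.id ℂ K)
        (t.isClosed_cyclic U _) ?_ (t.prod_mono hcyc.ge hE' hx)
      rintro _ ⟨z, rfl⟩ _ rfl
      have := hinv z _ hheC
      rwa [bi_tens, hE z _ heE] at this
    · intro x hx
      rw [mem_flipEigenspace, one_smul] at hx
      exact t.cyclic_le U (t.isClosed_cyclic U _) hinv hhhC
        (t.mem_cyclic_of_symmetric U hHinv hcyc hlim hx.1 hx.2)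
  obtain ⟨D, hDW, hDswap, hDmem, hDinj, hDdense⟩ :=
    t.exists_antisymmetric_intertwiner U hHinv (hlim 0)
  have hDS : ∀ x ∈ S, D x ∈ Q := by
    intro x hx
    rw [mem_flipEigenspace] at hx ⊢
    exact ⟨hDmem x hx.1, by rw [hDswap, hx.2, one_smul, neg_one_smul]⟩
  have hDQ : ∀ x ∈ Q, D x ∈ S := by
    intro x hx
    rw [mem_flipEigenspace] at hx ⊢
    exact ⟨hDmem x hx.1, by rw [hDswap, hx.2, neg_one_smul, map_neg, neg_neg, one_smul]⟩
  -- The intertwiner is the flip on H ⊗ E and the antisymmetric operator `D` on H ⊗ H.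
  set A : K →L[ℂ] K := t.swap.toLinearIsometry.toContinuousLinearMap.comp H₁.starProjection +
    D.comp HH.starProjection with hA
  have hAapp : ∀ x, A x = t.swap (H₁.starProjection x) + D (HH.starProjection x) := fun x => rfl
  have hAadd : ∀ y ∈ H₁, ∀ w ∈ S, A (y + w) = t.swap y + D w := by
    intro y hy w hw
    rw [hAapp, _root_.map_add H₁.starProjection, _root_.map_add HH.starProjection,
      Submodule.starProjection_eq_self_iff.2 hy,
      Submodule.starProjection_eq_self_iff.2 (hSle hw),
      (Submodule.starProjection_apply_eq_zero_iff _).2 (o1H.symm (hSle hw)),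
      (Submodule.starProjection_apply_eq_zero_iff _).2 (o1H hy), add_zero, zero_add]
  have hiso : RestrictionsIsomorphic (fun z => (t.bi U z z).toLinearIsometry)
      (H₁ ⊔ S) (H₂ ⊔ Q) := by
    refine restrictionsIsomorphic_of_intertwiner (fun z => t.bi U z z) _ _ hCc hDc hCinv
      (fun z x hx => by rw [bi_symm]; exact hCinv _ x hx) hDinv
      (fun z x hx => by rw [bi_symm]; exact hDinv _ x hx) A ?_ ?_ ?_ ?_
    · intro z x
      rw [hAapp, hAapp, t.starProjection_bi U H₁ (fun z y hy => t.bi_mem_prod U hHinv hEinv z z hy),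
        t.starProjection_bi U HH (fun z y hy => t.bi_mem_prod U hHinv hHinv z z hy), swap_bi, hDW,
        _root_.map_add]
    · intro x hx
      obtain ⟨y, hy, w, hw, rfl⟩ := Submodule.mem_sup.1 hx
      rw [hAadd y hy w hw]
      exact Submodule.add_mem_sup (t.swap_mem_prod hy) (hDS w hw)
    · intro x hx h0
      obtain ⟨y, hy, w, hw, rfl⟩ := Submodule.mem_sup.1 hx
      rw [hAadd y hy w hw] at h0
      obtain ⟨h1, h2⟩ := eq_zero_of_add_eq_zero_of_isOrtho o2H (t.swap_mem_prod hy)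
        (hDmem w (hSle hw)) h0
      have h3 : y = 0 := by simpa using h1
      rw [h3, hDinj w (hSle hw) h2, add_zero]
    · intro x hx h0
      obtain ⟨y, hy, w, hw, rfl⟩ := Submodule.mem_sup.1 hx
      have hy0 : y = 0 := by
        have := h0 (t.swap y + 0) (Submodule.add_mem_sup (t.swap_mem_prod hy) (S.zero_mem))
        rw [hAadd _ (t.swap_mem_prod hy) 0 S.zero_mem, swap_swap, _root_.map_zero, add_zero,
          inner_add_right, Submodule.isOrtho_iff_inner_eq.1 o2H y hy w (hQle hw), add_zero,
          inner_self_eq_zero] at this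
        exact this
      subst hy0
      rw [zero_add] at h0 ⊢
      -- Density of `D` is known on all of H ⊗ H. The antisymmetric part of `x` adds nothing new,
      -- since `D` maps it into S, orthogonally to `w`.
      refine hDdense w (hQle hw) fun x hx => ?_
      obtain ⟨x₁, hx₁, x₂, hx₂, rfl⟩ := t.exists_flip_decomposition hx
      have h1 := h0 (0 + x₁) (Submodule.add_mem_sup H₁.zero_mem hx₁)
      rw [hAadd 0 H₁.zero_mem x₁ hx₁, _root_.map_zero, zero_add] at h1
      rw [_root_.map_add, inner_add_left, h1, zero_add]
      exact Submodule.isOrtho_iff_inner_eq.1 oSQ _ (hDQ x₂ hx₂) _ hw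
  exact ⟨H₁ ⊔ S, H₂ ⊔ Q, hortho, hsup, hcycC,
    hcycC.of_restrictionsIsomorphic (fun x => t.bi_zero U x) hDc hiso, hCinv, hDinv, hiso⟩

end TensorSquare

/-! ### L²(μ × μ) as the tensor square of L²(μ). -/

section Products

variable {X : Type*} [MeasurableSpace X] (μ : Measure X)

theorem memLp_mul_prod (f g : Lp ℂ 2 μ) :
    MemLp (fun x : X × X => f x.1 * g x.2) 2 (μ.prod μ) := by
  have hf := Lp.memLp f
  have hg := Lp.memLp g
  have hm : AEStronglyMeasurable (fun x : X × X => f x.1 * g x.2) (μ.prod μ) :=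
    hf.1.comp_fst.mul hg.1.comp_snd
  rw [memLp_two_iff_integrable_sq_norm hm]
  have h := ((memLp_two_iff_integrable_sq_norm hf.1).1 hf).mul_prod
    ((memLp_two_iff_integrable_sq_norm hg.1).1 hg)
  simpa only [norm_mul, mul_pow] using h

theorem ae_fst {p : X → Prop} (h : ∀ᵐ x ∂μ, p x) : ∀ᵐ x ∂(μ.prod μ), p x.1 :=
  Measure.quasiMeasurePreserving_fst.ae h

theorem ae_snd {p : X → Prop} (h : ∀ᵐ x ∂μ, p x) : ∀ᵐ x ∂(μ.prod μ), p x.2 :=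
  Measure.quasiMeasurePreserving_snd.ae h

/-- The function `(x, y) ↦ f x * g y` in `L²(μ × μ)`. -/
def lpMul (f g : Lp ℂ 2 μ) : Lp ℂ 2 (μ.prod μ) := (memLp_mul_prod μ f g).toLp _

theorem coeFn_lpMul (f g : Lp ℂ 2 μ) :
    lpMul μ f g =ᵐ[μ.prod μ] fun x => f x.1 * g x.2 :=
  MemLp.coeFn_toLp _

theorem lpMul_eq_of_ae {f g : Lp ℂ 2 μ} {F : Lp ℂ 2 (μ.prod μ)}
    (h : F =ᵐ[μ.prod μ] fun x => f x.1 * g x.2) : lpMul μ f g = F :=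
  Lp.ext ((coeFn_lpMul μ f g).trans h.symm)

variable [IsProbabilityMeasure μ]

/-- Multiplication of functions of different variables, as a bilinear map. -/
def lpMulBilin : Lp ℂ 2 μ →ₗ[ℂ] Lp ℂ 2 μ →ₗ[ℂ] Lp ℂ 2 (μ.prod μ) :=
  LinearMap.mk₂ ℂ (lpMul μ)
    (fun f f' g => by
      refine lpMul_eq_of_ae μ ?_
      filter_upwards [Lp.coeFn_add (lpMul μ f g) (lpMul μ f' g), coeFn_lpMul μ f g,
        coeFn_lpMul μ f' g, ae_fst μ (Lp.coeFn_add f f')] with x h1 h2 h3 h4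
      rw [h1, h4, Pi.add_apply, Pi.add_apply, h2, h3, add_mul])
    (fun c f g => by
      refine lpMul_eq_of_ae μ ?_
      filter_upwards [Lp.coeFn_smul c (lpMul μ f g), coeFn_lpMul μ f g,
        ae_fst μ (Lp.coeFn_smul c f)] with x h1 h2 h3
      rw [h1, h3, Pi.smul_apply, Pi.smul_apply, h2, smul_mul_assoc])
    (fun f g g' => by
      refine lpMul_eq_of_ae μ ?_
      filter_upwards [Lp.coeFn_add (lpMul μ f g) (lpMul μ f g'), coeFn_lpMul μ f g,
        coeFn_lpMul μ f g', ae_snd μ (Lp.coeFn_add g g')] with x h1 h2 h3 h4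
      rw [h1, h4, Pi.add_apply, Pi.add_apply, h2, h3, mul_add])
    (fun c f g => by
      refine lpMul_eq_of_ae μ ?_
      filter_upwards [Lp.coeFn_smul c (lpMul μ f g), coeFn_lpMul μ f g,
        ae_snd μ (Lp.coeFn_smul c g)] with x h1 h2 h3
      rw [h1, h3, Pi.smul_apply, Pi.smul_apply, h2, mul_smul_comm])

theorem inner_lpMul (f g f' g' : Lp ℂ 2 μ) :
    inner ℂ (lpMul μ f g) (lpMul μ f' g') = inner ℂ f f' * inner ℂ g g' := by
  rw [L2.inner_def, L2.inner_def, L2.inner_def, ← integral_prod_mul]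
  refine integral_congr_ae ?_
  filter_upwards [coeFn_lpMul μ f g, coeFn_lpMul μ f' g'] with x h1 h2
  rw [h1, h2]
  simp only [RCLike.inner_apply, map_mul]
  ring

/-- The isometric embedding of the algebraic tensor square of `L²(μ)` into `L²(μ × μ)`. -/
def lpTensor : Lp ℂ 2 μ ⊗[ℂ] Lp ℂ 2 μ →ₗᵢ[ℂ] Lp ℂ 2 (μ.prod μ) :=
  (TensorProduct.lift (lpMulBilin μ)).isometryOfInner (fun x y => by
    induction x using TensorProduct.induction_on with
    | zero => simp
    | add x x' hx hx' => rw [map_add, inner_add_left, inner_add_left, hx, hx']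
    | tmul f g =>
      induction y using TensorProduct.induction_on with
      | zero => simp
      | add y y' hy hy' => rw [map_add, inner_add_right, inner_add_right, hy, hy']
      | tmul f' g' =>
        rw [TensorProduct.lift.tmul, TensorProduct.lift.tmul, TensorProduct.inner_tmul]
        exact inner_lpMul μ f g f' g')

theorem lpTensor_tmul (f g : Lp ℂ 2 μ) : lpTensor μ (f ⊗ₜ[ℂ] g) = lpMul μ f g :=
  TensorProduct.lift.tmul _ _

theorem lpMul_indicator {s t : Set X} (hs : MeasurableSet s) (ht : MeasurableSet t) :
    lpMul μ (indicatorConstLp 2 hs (measure_ne_top μ s) (1 : ℂ))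
      (indicatorConstLp 2 ht (measure_ne_top μ t) (1 : ℂ)) =
    indicatorConstLp 2 (hs.prod ht) (measure_ne_top (μ.prod μ) _) (1 : ℂ) := by
  refine lpMul_eq_of_ae μ ?_
  filter_upwards [indicatorConstLp_coeFn (p := 2) (hs := hs.prod ht)
      (hμs := measure_ne_top (μ.prod μ) _) (c := (1 : ℂ)),
    ae_fst μ (indicatorConstLp_coeFn (p := 2) (hs := hs) (hμs := measure_ne_top μ s)
      (c := (1 : ℂ))),
    ae_snd μ (indicatorConstLp_coeFn (p := 2) (hs := ht) (hμs := measure_ne_top μ t)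
      (c := (1 : ℂ)))] with x h1 h2 h3
  rw [h1, h2, h3]
  by_cases h1 : x.1 ∈ s <;> by_cases h2 : x.2 ∈ t <;> simp [Set.indicator, h1, h2]

/-- A function in `L²(μ × μ)` whose integrals over all rectangles vanish is zero. -/
theorem eq_zero_of_setIntegral_prod (F : Lp ℂ 2 (μ.prod μ))
    (h : ∀ s t : Set X, MeasurableSet s → MeasurableSet t →
      ∫ x in s ×ˢ t, F x ∂(μ.prod μ) = 0) : F = 0 := by
  have hint : Integrable F (μ.prod μ) := (Lp.memLp F).integrable (by norm_num)
  have hall : ∀ s, MeasurableSet s → ∫ x in s, F x ∂(μ.prod μ) = 0 := by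
    intro s hs
    induction s, hs using MeasurableSpace.induction_on_inter generateFrom_prod.symm
      isPiSystem_prod with
    | empty => simp
    | basic s hs =>
      obtain ⟨s, hs, t, ht, rfl⟩ := hs
      exact h s t hs ht
    | compl s hs ih =>
      have h1 := integral_add_compl hs hint
      have h2 := h Set.univ Set.univ MeasurableSet.univ MeasurableSet.univ
      rw [Set.univ_prod_univ, Measure.restrict_univ] at h2
      rwa [ih, zero_add, h2] at h1
    | iUnion f hd hf ih =>
      rw [integral_iUnion hf hd hint.integrableOn]
      simp [ih]
  exact (Lp.eq_zero_iff_ae_eq_zero).2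
    (hint.ae_eq_zero_of_forall_setIntegral_eq_zero (fun s hs _ => hall s hs))

/-- `L²(μ × μ)` as the Hilbert tensor square of `L²(μ)`. -/
def lpTensorSquare : TensorSquare (Lp ℂ 2 μ) (Lp ℂ 2 (μ.prod μ)) where
  embedding := lpTensor μ
  denseRange := by
    have : (LinearMap.range (lpTensor μ).toLinearMap).topologicalClosure = ⊤ := by
      rw [Submodule.topologicalClosure_eq_top_iff, Submodule.eq_bot_iff]
      intro F hF
      refine eq_zero_of_setIntegral_prod μ F fun s t hs ht => ?_
      -- The integral over a rectangle is an inner product with a tensor of indicators, so it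
      -- vanishes on the complement of the range.
      rw [← L2.inner_indicatorConstLp_one (𝕜 := ℂ) (hs.prod ht) (measure_ne_top (μ.prod μ) _) F,
        ← lpMul_indicator μ hs ht, ← lpTensor_tmul]
      exact Submodule.inner_right_of_mem_orthogonal (LinearMap.mem_range_self _ _) hF
    intro x
    have hx : x ∈ (LinearMap.range (lpTensor μ).toLinearMap).topologicalClosure := by
      rw [this]; trivial
    exact hx

theorem tens_lpTensorSquare (f g : Lp ℂ 2 μ) : (lpTensorSquare μ).tens f g = lpMul μ f g :=
  lpTensor_tmul μ f g

end Products

/-! ### Koopman operators of the action and of its diagonal action. -/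

section Koopman

variable {X : Type*} [MeasurableSpace X] {μ : Measure X}

theorem coeFn_koopman (T : Action μ) (z : ℤ × ℤ) (f : Lp ℂ 2 μ) :
    T.koopman z f =ᵐ[μ] f ∘ T.toFun z :=
  Lp.coeFn_compMeasurePreserving f (T.measurePreserving z)

theorem koopman_zero (T : Action μ) (f : Lp ℂ 2 μ) : T.koopman 0 f = f := by
  refine Lp.ext ((coeFn_koopman T 0 f).trans ?_)
  filter_upwards [T.map_zero] with x hx
  rw [Function.comp_apply, hx, id]

theorem koopman_add (T : Action μ) (z w : ℤ × ℤ) (f : Lp ℂ 2 μ) :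
    T.koopman (z + w) f = T.koopman z (T.koopman w f) := by
  -- Composition with maps reverses order, which is harmless in an abelian group.
  rw [add_comm]
  refine Lp.ext ((coeFn_koopman T (w + z) f).trans ?_)
  filter_upwards [T.map_add w z, coeFn_koopman T z (T.koopman w f),
    (T.measurePreserving z).quasiMeasurePreserving.ae (coeFn_koopman T w f)] with x h1 h2 h3
  rw [h2, Function.comp_apply, Function.comp_apply, h1, h3, Function.comp_apply,
    Function.comp_apply]

/-- The operators of an action form a unitary representation. -/
def koopmanRep (T : Action μ) : UnitaryRep (Lp ℂ 2 μ) where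
  toFun z :=
    { toFun := T.koopman z
      invFun := T.koopman (-z)
      map_add' := map_add (T.koopman z)
      map_smul' := map_smul (T.koopman z)
      left_inv := fun f => by rw [← koopman_add, neg_add_cancel, koopman_zero]
      right_inv := fun f => by rw [← koopman_add, add_neg_cancel, koopman_zero]
      norm_map' := (T.koopman z).norm_map }
  map_zero := LinearIsometryEquiv.ext (koopman_zero T)
  map_add z w := LinearIsometryEquiv.ext (koopman_add T z w)

variable [IsProbabilityMeasure μ]

theorem koopman_diag_lpMul (T : Action μ) (z : ℤ × ℤ) (f g : Lp ℂ 2 μ) :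
    T.diag.koopman z (lpMul μ f g) = lpMul μ (T.koopman z f) (T.koopman z g) := by
  symm
  refine lpMul_eq_of_ae μ ((coeFn_koopman T.diag z _).trans ?_)
  filter_upwards [(T.diag.measurePreserving z).quasiMeasurePreserving.ae (coeFn_lpMul μ f g),
    ae_fst μ (coeFn_koopman T z f), ae_snd μ (coeFn_koopman T z g)] with x h1 h2 h3
  rw [Function.comp_apply, h1, h2, h3]
  rfl

theorem koopman_diag (T : Action μ) :
    T.diag.koopman = fun z => ((lpTensorSquare μ).bi (koopmanRep T) z z).toLinearIsometry := by
  funext z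
  refine LinearIsometry.ext fun x => ?_
  refine (lpTensorSquare μ).ext_of_tens (T.diag.koopman z).toContinuousLinearMap
    ((lpTensorSquare μ).bi (koopmanRep T) z z).toLinearIsometry.toContinuousLinearMap
    (fun f g => ?_) x
  change T.diag.koopman z ((lpTensorSquare μ).tens f g) =
    (lpTensorSquare μ).bi (koopmanRep T) z z ((lpTensorSquare μ).tens f g)
  rw [TensorSquare.bi_tens, tens_lpTensorSquare, tens_lpTensorSquare, koopman_diag_lpMul]
  rfl

theorem koopman_constants (T : Action μ) (z : ℤ × ℤ) {f : Lp ℂ 2 μ} (hf : f ∈ constants μ) :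
    T.koopman z f = f := by
  obtain ⟨c, rfl⟩ := Submodule.mem_span_singleton.1 hf
  rw [map_smul]
  congr 1

theorem prod_constants :
    (lpTensorSquare μ).prod (constants μ) (constants μ) = constants (μ.prod μ) := by
  have h1 : (lpTensorSquare μ).tens (Lp.const 2 μ (1 : ℂ)) (Lp.const 2 μ (1 : ℂ)) =
      Lp.const 2 (μ.prod μ) (1 : ℂ) := by
    rw [tens_lpTensorSquare]
    refine lpMul_eq_of_ae μ ?_
    filter_upwards [Lp.coeFn_const 2 (μ.prod μ) (1 : ℂ), ae_fst μ (Lp.coeFn_const 2 μ (1 : ℂ)),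
      ae_snd μ (Lp.coeFn_const 2 μ (1 : ℂ))] with x h1 h2 h3
    rw [h1, h2, h3]
    simp
  refine le_antisymm ?_ ?_
  · have hc : IsClosed (constants (μ.prod μ) : Set (Lp ℂ 2 (μ.prod μ))) := by
      unfold constants
      exact Submodule.closed_of_finiteDimensional _
    refine closure_span_le _ _ hc ?_
    rintro _ ⟨f, hf, g, hg, rfl⟩
    obtain ⟨c, rfl⟩ := Submodule.mem_span_singleton.1 hf
    obtain ⟨d, rfl⟩ := Submodule.mem_span_singleton.1 hg
    rw [TensorSquare.tens_smul_left, TensorSquare.tens_smul_right, h1]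
    exact Submodule.smul_mem _ _ (Submodule.smul_mem _ _ (Submodule.mem_span_singleton_self _))
  · refine (Submodule.span_singleton_le_iff_mem _ _).2 ?_
    rw [← h1]
    exact TensorSquare.tens_mem_prod _ (Submodule.mem_span_singleton_self _)
      (Submodule.mem_span_singleton_self _)

/-- Θ vanishes on `H`, which removes the third term, and its positive weight `c` survives only as
the strict inequality a + b < 1. -/
theorem hasLimitOn_of_weakLimit (T : Action μ) {m : ℤ × ℤ} {a b c : ℝ} (ha : 0 < a) (hb : 0 < b)
    (hc : 0 < c) (hsum : a + b + c = 1)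
    (hlim : HasWeakLimit T.koopman ((a : ℂ) • ContinuousLinearMap.id ℂ (Lp ℂ 2 μ)
        + (b : ℂ) • (T.koopman m).toContinuousLinearMap + (c : ℂ) • Theta μ)) :
    ∃ p, HasLimitOn (koopmanRep T) (constants μ)ᗮ m a b p := by
  obtain ⟨p, hp⟩ := hlim
  refine ⟨p, ha, hb, by linarith, fun f hf g => ?_⟩
  have h := hp f g
  have h0 : Theta μ f = 0 := (Submodule.starProjection_apply_eq_zero_iff _).2 hf
  have h1 : ((a : ℂ) • ContinuousLinearMap.id ℂ (Lp ℂ 2 μ)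
        + (b : ℂ) • (T.koopman m).toContinuousLinearMap + (c : ℂ) • Theta μ) f =
      (a : ℂ) • f + (b : ℂ) • T.koopman m f := by
    change (a : ℂ) • f + (b : ℂ) • T.koopman m f + (c : ℂ) • Theta μ f = _
    rw [h0, smul_zero, add_zero]
  rw [h1] at h
  exact h

end Koopman

end Z2Spectrum

end

theorem mainTheorem1 {X : Type*} [MeasurableSpace X] (μ : Measure X) [IsProbabilityMeasure μ]
    (T : Z2Spectrum.Action μ) (hT : T.IsTotallyErgodic) (hsimple : T.HasSimpleSpectrum)
    (a b c : Fin 3 → ℝ) (ha : ∀ j, 0 < a j) (hb : ∀ j, 0 < b j) (hc : ∀ j, 0 < c j)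
    (hsum : ∀ j, a j + b j + c j = 1)
    (hlim : ∀ j : Fin 3, Z2Spectrum.HasWeakLimit T.koopman
      (((a j : ℝ) : ℂ) • ContinuousLinearMap.id ℂ (Lp ℂ 2 μ)
        + ((b j : ℝ) : ℂ) •
          (T.koopman ((![(1, 0), (0, 1), (1, 1)] : Fin 3 → ℤ × ℤ) j)).toContinuousLinearMap
        + ((c j : ℝ) : ℂ) • Z2Spectrum.Theta μ)) :
    T.diag.HasHomogeneousSpectrum 2 := by
  obtain ⟨h, hh⟩ := hsimple
  choose p hp using fun j =>
    Z2Spectrum.hasLimitOn_of_weakLimit T (ha j) (hb j) (hc j) (hsum j) (hlim j)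
  obtain ⟨C, D, hCD, hsup, hC, hD, hCinv, hDinv, hiso⟩ :=
    (Z2Spectrum.lpTensorSquare μ).exists_cyclic_decomposition (Z2Spectrum.koopmanRep T)
      (E := Z2Spectrum.constants μ) (fun z f hf => Z2Spectrum.koopman_constants T z hf)
      rfl hh hp
  rw [Z2Spectrum.prod_constants] at hsup
  rw [← Z2Spectrum.koopman_diag] at hC hD hiso
  refine ⟨![C, D], ?_, ?_, ?_, ?_⟩
  · intro i
    fin_cases i
    exacts [hC, hD]
  · intro i j hij
    fin_cases i <;> fin_cases j
    exacts [absurd rfl hij, hCD, hCD.symm, absurd rfl hij]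
  · rw [Z2Spectrum.L20, ← hsup]
    exact le_antisymm (iSup_le (Fin.forall_fin_two.2 ⟨le_sup_left, le_sup_right⟩))
      (sup_le (le_iSup ![C, D] 0) (le_iSup ![C, D] 1))
  · have hC' : ∀ z, ∀ x ∈ C, T.diag.koopman z x ∈ C := by
      rw [Z2Spectrum.koopman_diag]; exact hCinv
    have hD' : ∀ z, ∀ x ∈ D, T.diag.koopman z x ∈ D := by
      rw [Z2Spectrum.koopman_diag]; exact hDinv
    intro i j
    fin_cases i <;> fin_cases j
    exacts [.refl _ _ hC', hiso, hiso.symm, .refl _ _ hD']
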